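/- Let $d\ge 1$ and let $M$ be a finite regular CW-complex with no cells of dimension greater than $d$ (the attaching maps are homeomorphisms onto subcomplexes, and two closed cells are disjoint or meet in a single closed cell). Its cells of dimension $d$, $d-1$, $d-2$ are called $d$-faces, $d$-edges and $d$-vertices. An R-framework $\mathcal R=(M,p)$ is a map $p$ from the vertices of $M$ to $\mathbb R^{d+1}$ such that the image of the vertex set of each $k$-cell $x$ spans an affine $k$-plane $\langle p(x)\rangle$. Assume that $\mathcal R$ is generic (two different $d$-faces sharing a $d$-edge span different $d$-planes), trivalent (each $d$-edge lies in exactly three $d$-faces) and face-connected (there is a $d$-face, and any two $d$-faces are joined by a sequence of $d$-faces in which consecutive ones share a $d$-edge). For a $d$-edge $e$ of a $d$-face $f$ let $\mathbf n(e,f)$ be the unit vector parallel to $\langle p(f)\rangle$ and normal to $\langle p(e)\rangle$ which is dictated by orientations: fix orientations of the cells and of the planes $\langle p(e)\rangle,\langle p(f)\rangle$; then $\mathbf n(e,f)$ followed by the orientation of $\langle p(e)\rangle$ is $[f:e]$ times the orientation of $\langle p(f)\rangle$, where $[f:e]=\pm1$ is the incidence number. (If the faces are convex polytopes, for each $f$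 all $\mathbf n(e,f)$ point into $p(f)$ or all point out of it.) A self-stress is a real function $s$ on the $d$-faces with $\sum_{f\supset e}s(f)\,\mathbf n(e,f)=0$ for every $d$-edge $e$; $\mathcal R$ is self-stressable if it has a non-zero self-stress. A face-cycle is a sequence of $d$-faces $f_0,\dots,f_k=f_0$ with distinct $d$-edges $e_1,\dots,e_k$ such that $e_i$ lies in $f_{i-1}$ and $f_i$ and $f_{i-1}\ne f_i$; it is a face-loop if $f_0,\dots,f_{k-1}$ are distinct. By equilibrium at $e_1$, a stress on $f_0$ determines the stress on $f_1$, this determines the stress on $f_2$ by equilibrium at $e_2$, and so on; if a non-zero stress $s$ on $f_0$ is transported in this way around the cycle to a stress $s'$ on $f_0$, the stress monodromy of the cycle is $s/s'$, and it is trivial if it equals $1$. For a $d$-vertex $v$ let $\mathcal S_v$ be the framework on the unit sphere $S^2$ of the $3$-dimensional space $h$ orthogonal to $\langle p(v)\rangle$ whose vertices are the $d$-edges $e$ containing $v$, each placed at a point where the projection of $\langle p(e)\rangle$ to $h$ meets $S^2$, and whose edges are the $d$-faces $f$ containing $v$, each drawn as an arc of the great circle cut out by the projection of $\langle p(f)\rangle$,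 joining the two $d$-edges of $f$ containing $v$. It is self-stressable if there are weights on its arcs, not all zero, such that at each vertex the weighted sum of the unit tangents of the arcs emanating from it vanishes. (This does not depend on the choice among antipodal points or complementary arcs.) Then: (i) $\mathcal R$ is self-stressable if and only if every face-loop has trivial stress monodromy. Assume moreover that in $M$ the link of every cell of dimension at most $d-2$ is non-empty and connected, and that the link of every cell of dimension at most $d-3$ has trivial first integral homology group (the second condition is void for $d\le 2$; both hold if $M$ is the $d$-skeleton of a closed $(d+1)$-manifold). Then: (ii) $H_1(M;\mathbb Z)$ has finite systems of generators represented by face-cycles, and $\mathcal R$ is self-stressable if and only if (a) $\mathcal S_v$ is self-stressable for every $d$-vertex $v$, and (b) for some face-cycles $\gamma_1,\dots,\gamma_k$ whose classes generate $H_1(M;\mathbb Z)$, all the stress monodromies are trivial. Moreover, in (b) "for some" may be replaced by any fixed choice of such face-cycles. (iii) If $M$ is simply connected, then $\mathcal R$ is self-stressable if and only if $\mathcal S_v$ is self-stressable for every $d$-vertex $v$. -/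

import Mathlib

/-! Trivalent R-frameworks: regular CW-complexes, realizations, self-stresses, stress monodromy,
local spherical frameworks, first homology. -/

noncomputable section

namespace RFw

open scoped RealInnerProductSpace

universe u

/-! ### Cells of a CW-complex -/

section Cells

variable {X : Type u} [TopologicalSpace X] (C : Set X) [Topology.CWComplex C]

/-- The cells of all dimensions of a CW-complex. -/
structure Cell where
  dim : ℕ
  idx : Topology.RelCWComplex.cell C dim

variable {C}

/-- The closed cell, as a subset of the ambient space. -/
def Cell.carrier (x : Cell C) : Set X := Topology.RelCWComplex.closedCell x.dim x.idx

/-- Cells are ordered by inclusion of closed cells: `x < y` means that `x` is a proper face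
of `y`. -/
instance : Preorder (Cell C) := Preorder.lift Cell.carrier

variable (C)

/-- Regular CW-complexes: the characteristic maps are injective on closed balls (hence
homeomorphisms onto the closed cells), the boundary of every cell is a subcomplex, and two closed
cells are disjoint or meet in a single closed cell. -/
structure IsRegular : Prop where
  injOn : ∀ (n : ℕ) (i : Topology.RelCWComplex.cell C n),
    Set.InjOn (Topology.RelCWComplex.map n i) (Metric.closedBall 0 1)
  frontier : ∀ (n : ℕ) (i : Topology.RelCWComplex.cell C n),
    ∃ A : Topology.RelCWComplex.Subcomplex C,
      (A : Set X) = Topology.RelCWComplex.cellFrontier n i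
  inter : ∀ x y : Cell C, x.carrier ∩ y.carrier = ∅ ∨ ∃ z : Cell C, x.carrier ∩ y.carrier = z.carrier

/-- The `d`-faces: cells of dimension `d`. -/
abbrev Face (d : ℕ) := {x : Cell C // x.dim = d}

/-- The `d`-edges: cells of dimension `d - 1`. -/
abbrev Edge (d : ℕ) := {x : Cell C // x.dim + 1 = d}

/-- The `d`-vertices: cells of dimension `d - 2`. -/
abbrev DVertex (d : ℕ) := {x : Cell C // x.dim + 2 = d}

/-- There is a `d`-face, and any two `d`-faces are joined by a sequence of `d`-faces in which
consecutive ones share a `d`-edge. -/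
def FaceConnected (d : ℕ) : Prop :=
  Nonempty (Face C d) ∧ ∀ f g : Face C d,
    Relation.ReflTransGen
      (fun a b : Face C d => ∃ e : Edge C d, e.1 < a.1 ∧ e.1 < b.1) f g

/-- Each `d`-edge is incident to exactly three `d`-faces. -/
def Trivalent (d : ℕ) : Prop :=
  ∀ e : Edge C d, Nat.card {f : Face C d // e.1 < f.1} = 3

/-- A combinatorial orientation of all cells, recorded by its incidence numbers `[x : y]`. -/
structure IncidenceFunction where
  inc : Cell C → Cell C → ℤ
  unit : ∀ x y : Cell C, y < x → y.dim + 1 = x.dim → inc x y = 1 ∨ inc x y = -1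
  zero : ∀ x y : Cell C, ¬ (y < x ∧ y.dim + 1 = x.dim) → inc x y = 0
  edge : ∀ x : Cell C, x.dim = 1 → ∑ᶠ y : {y : Cell C // y.dim = 0 ∧ y < x}, inc x y = 0
  square : ∀ x z : Cell C, z < x → z.dim + 2 = x.dim →
    ∑ᶠ y : {y : Cell C // y.dim = z.dim + 1 ∧ z < y ∧ y < x}, inc x y * inc y z = 0

end Cells

/-! ### First homology

The integral simplicial homology of the order complex of a poset. For the poset of cells of a
regular CW-complex the order complex is its barycentric subdivision; for the poset of the cells
lying strictly above a cell it is the link of that cell. -/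

section Homology

variable (P : Type u) [Preorder P]

abbrev Chain0 := P →₀ ℤ

abbrev Chain1 := {s : P × P // s.1 < s.2} →₀ ℤ

abbrev Chain2 := {t : P × P × P // t.1 < t.2.1 ∧ t.2.1 < t.2.2} →₀ ℤ

/-- `∂[a, b] = [b] - [a]`. -/
def bd1 : Chain1 P →ₗ[ℤ] Chain0 P :=
  Finsupp.linearCombination ℤ fun s => Finsupp.single s.1.2 1 - Finsupp.single s.1.1 1

/-- `∂[a, b, c] = [b, c] - [a, c] + [a, b]`. -/
def bd2 : Chain2 P →ₗ[ℤ] Chain1 P :=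
  Finsupp.linearCombination ℤ fun t =>
    Finsupp.single ⟨(t.1.2.1, t.1.2.2), t.2.2⟩ 1
      - Finsupp.single ⟨(t.1.1, t.1.2.2), t.2.1.trans t.2.2⟩ 1
      + Finsupp.single ⟨(t.1.1, t.1.2.1), t.2.1⟩ 1

/-- First homology group, with integer coefficients: cycles modulo boundaries. -/
abbrev H1 :=
  LinearMap.ker (bd1 P) ⧸ (LinearMap.range (bd2 P)).submoduleOf (LinearMap.ker (bd1 P))

end Homology

/-! ### Face-paths and face-cycles -/

section Paths

variable {X : Type u} [TopologicalSpace X] (C : Set X) [Topology.CWComplex C]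

/-- The link of every cell of dimension at most `d - 2` is non-empty and connected, and the link
of every cell of dimension at most `d - 3` has trivial first homology group. -/
def LinkCondition (d : ℕ) : Prop :=
  (∀ x : Cell C, x.dim + 2 ≤ d →
    Nonempty (Set.Ioi x) ∧ ∀ y z : Set.Ioi x, Relation.EqvGen (fun a b => a ≤ b) y z) ∧
  (∀ x : Cell C, x.dim + 3 ≤ d → Subsingleton (H1 (Set.Ioi x)))

/-- A face-path: `d`-faces `f₀, …, f_k` and distinct `d`-edges `e₁, …, e_k`, where `e_i` is
incident to the two distinct `d`-faces `f_{i-1}` and `f_i`. -/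
structure FacePath (d : ℕ) where
  length : ℕ
  face : Fin (length + 1) → Face C d
  edge : Fin length → Edge C d
  left : ∀ i : Fin length, (edge i).1 < (face i.castSucc).1
  right : ∀ i : Fin length, (edge i).1 < (face i.succ).1
  ne : ∀ i : Fin length, face i.castSucc ≠ face i.succ
  edge_injective : Function.Injective edge

/-- A face-cycle: a face-path that returns to its first `d`-face. -/
structure FaceCycle (d : ℕ) extends FacePath C d where
  closed : face 0 = face (Fin.last length)

variable {C} {d : ℕ}

/-- A face-loop: a face-cycle without repeated `d`-faces. -/
def FaceCycle.IsLoop (γ : FaceCycle C d) : Prop :=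
  Function.Injective fun i : Fin γ.length => γ.face i.castSucc

/-- The curve `f₀, e₁, f₁, …, e_k, f_k` as a 1-chain of the barycentric subdivision. -/
def FacePath.chain (γ : FacePath C d) : Chain1 (Cell C) :=
  ∑ i : Fin γ.length,
    (Finsupp.single ⟨((γ.edge i).1, (γ.face i.succ).1), γ.right i⟩ 1
      - Finsupp.single ⟨((γ.edge i).1, (γ.face i.castSucc).1), γ.left i⟩ 1)

theorem sum_fin_sub {A : Type*} [AddCommGroup A] (n : ℕ) (g : Fin (n + 1) → A) :
    ∑ i : Fin n, (g i.succ - g i.castSucc) = g (Fin.last n) - g 0 := by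
  have h1 := Fin.sum_univ_succ g
  have h2 := Fin.sum_univ_castSucc g
  rw [Finset.sum_sub_distrib, sub_eq_sub_iff_add_eq_add, add_comm _ (g 0), ← h1, h2, add_comm]

theorem FacePath.bd1_chain (γ : FacePath C d) :
    bd1 (Cell C) γ.chain =
      Finsupp.single (γ.face (Fin.last γ.length)).1 1 - Finsupp.single (γ.face 0).1 1 := by
  rw [← sum_fin_sub γ.length (fun i => (Finsupp.single (γ.face i).1 1 : Chain0 (Cell C)))]
  simp [FacePath.chain, bd1, map_sum, map_sub, Finsupp.linearCombination_single]

/-- The homology class of a face-cycle. -/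
def FaceCycle.homologyClass (γ : FaceCycle C d) : H1 (Cell C) :=
  Submodule.Quotient.mk ⟨γ.chain, by
    rw [LinearMap.mem_ker, FacePath.bd1_chain, γ.closed, sub_self]⟩

/-- The classes of the face-cycles `γ₁, …, γ_k` generate the first homology group. -/
def GenerateH1 {k : ℕ} (γ : Fin k → FaceCycle C d) : Prop :=
  Submodule.span ℤ (Set.range fun i => (γ i).homologyClass) = ⊤

end Paths

/-! ### R-frameworks and their self-stresses -/

section Frameworks

variable {X : Type u} [TopologicalSpace X] (C : Set X) [Topology.CWComplex C]

/-- An R-framework in `ℝ^{d+1}`: the complex has no cells of dimension greater than `d`, and the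
vertex set of each `k`-cell is mapped to points spanning an affine `k`-plane. -/
structure RFramework (d : ℕ) where
  dim_le : ∀ x : Cell C, x.dim ≤ d
  p : Topology.RelCWComplex.cell C 0 → EuclideanSpace ℝ (Fin (d + 1))
  realizes : ∀ x : Cell C,
    Module.finrank ℝ (vectorSpan ℝ (p '' {w | (⟨0, w⟩ : Cell C) ≤ x})) = x.dim

variable {C} {d : ℕ}

/-- The affine span of the image of the vertex set of a cell. -/
def RFramework.plane (R : RFramework C d) (x : Cell C) :
    AffineSubspace ℝ (EuclideanSpace ℝ (Fin (d + 1))) :=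
  affineSpan ℝ (R.p '' {w | (⟨0, w⟩ : Cell C) ≤ x})

/-- The linear space of direction vectors of the plane of a cell. -/
def RFramework.dir (R : RFramework C d) (x : Cell C) :
    Submodule ℝ (EuclideanSpace ℝ (Fin (d + 1))) :=
  vectorSpan ℝ (R.p '' {w | (⟨0, w⟩ : Cell C) ≤ x})

/-- Two `d`-faces sharing a `d`-edge span different planes. -/
def RFramework.Generic (R : RFramework C d) : Prop :=
  ∀ (e : Edge C d) (f g : Face C d), e.1 < f.1 → e.1 < g.1 → f ≠ g → R.plane f.1 ≠ R.plane g.1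

/-- The matrix of inner products of an orthonormal basis of the plane of the `d`-face `f` with the
vectors `n, b₁, …, b_{d-1}`, where `b` is an orthonormal basis of the plane of the `d`-edge `e`.
If `n` is a unit vector in the plane of `f` normal to the plane of `e` and `e` is contained in `f`,
this is the change-of-basis matrix, and its determinant is `1` or `-1` according to whether `n`
followed by the orientation of `e` is the orientation of `f`. -/
def RFramework.frameMatrix (R : RFramework C d)
    (b : ∀ x : Cell C, OrthonormalBasis (Fin x.dim) ℝ (R.dir x))
    (e : Edge C d) (f : Face C d) (n : EuclideanSpace ℝ (Fin (d + 1))) :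
    Matrix (Fin f.1.dim) (Fin f.1.dim) ℝ :=
  Matrix.of fun i j =>
    ⟪(b f.1 i : EuclideanSpace ℝ (Fin (d + 1))),
      (Fin.cons n (fun k => (b e.1 k : EuclideanSpace ℝ (Fin (d + 1)))) :
        Fin (e.1.dim + 1) → EuclideanSpace ℝ (Fin (d + 1)))
        (Fin.cast (f.2.trans e.2.symm) j)⟫

/-- The unit normals `n(e, f)` dictated by an R-framework. They depend on a choice of
combinatorial orientations of the cells (through the incidence numbers) and of orientations of the
planes (given by orthonormal bases): `n(e, f)` is the unit vector in the plane of `f` normal to `e`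
such that `n(e, f)` followed by the orientation that `e` carries as a boundary piece of the
oriented cell `f` is the orientation of the plane of `f`. If `f` is realized by a convex polytope,
all the `n(e, f)` point into it or all point out of it. -/
structure Normals (R : RFramework C d) where
  orientation : IncidenceFunction C
  basis : ∀ x : Cell C, OrthonormalBasis (Fin x.dim) ℝ (R.dir x)
  n : Edge C d → Face C d → EuclideanSpace ℝ (Fin (d + 1))
  mem : ∀ e f, e.1 < f.1 → n e f ∈ R.dir f.1
  perp : ∀ e f, e.1 < f.1 → n e f ∈ (R.dir e.1)ᗮ
  norm_eq : ∀ e f, e.1 < f.1 → ‖n e f‖ = 1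
  oriented : ∀ e f, e.1 < f.1 →
    (R.frameMatrix basis e f (n e f)).det = (orientation.inc f.1 e.1 : ℝ)

namespace Normals

variable {R : RFramework C d} (N : Normals R)

/-- The equilibrium condition at the `d`-edge `e`. -/
def EquilibriumAt (s : Face C d → ℝ) (e : Edge C d) : Prop :=
  ∑ᶠ f : {f : Face C d // e.1 < f.1}, s f.1 • N.n e f.1 = 0

/-- There is a non-zero self-stress. -/
def SelfStressable : Prop :=
  ∃ s : Face C d → ℝ, s ≠ 0 ∧ ∀ e : Edge C d, N.EquilibriumAt s e

/-- The values `σ₀, …, σ_k` on the successive faces of a face-path arise from each other by stress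
transition: at each `e_i` the stresses `σ_{i-1}` on `f_{i-1}` and `σ_i` on `f_i` are completed to
an equilibrium at `e_i` by some stress on the remaining face at `e_i`. -/
def IsTransition (γ : FacePath C d) (σ : Fin (γ.length + 1) → ℝ) : Prop :=
  ∀ i : Fin γ.length, ∃ τ : Face C d → ℝ,
    τ (γ.face i.castSucc) = σ i.castSucc ∧ τ (γ.face i.succ) = σ i.succ ∧
      N.EquilibriumAt τ (γ.edge i)

/-- The stress monodromy along a face-cycle is `m`: a non-zero stress `s` on the first face is
carried around the cycle to a stress `s'` on the same face with `m = s / s'`. -/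
def HasMonodromy (γ : FaceCycle C d) (m : ℝ) : Prop :=
  ∃ σ : Fin (γ.length + 1) → ℝ, N.IsTransition γ.toFacePath σ ∧
    σ 0 ≠ 0 ∧ σ (Fin.last γ.length) ≠ 0 ∧ m = σ 0 / σ (Fin.last γ.length)

/-- The stress monodromy is `1`. -/
def TrivialMonodromy (γ : FaceCycle C d) : Prop := N.HasMonodromy γ 1

end Normals

end Frameworks

/-! ### Spherical frameworks -/

section Spherical

/-- A framework in the unit sphere of a Euclidean space `H`, with vertices indexed by `V` and
geodesic arcs indexed by `A`. The arc `a` starts at `pos (tail a)` with unit tangent `dir a` and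
runs along its great circle through the angle `angle a` to `pos (head a)`. -/
structure SphericalFramework (H : Type*) [NormedAddCommGroup H] [InnerProductSpace ℝ H]
    (V A : Type*) where
  pos : V → H
  tail : A → V
  head : A → V
  dir : A → H
  angle : A → ℝ
  norm_pos : ∀ u, ‖pos u‖ = 1
  norm_dir : ∀ a, ‖dir a‖ = 1
  dir_perp : ∀ a, ⟪pos (tail a), dir a⟫ = 0
  angle_nonneg : ∀ a, 0 ≤ angle a
  pos_head : ∀ a, pos (head a) = Real.cos (angle a) • pos (tail a) + Real.sin (angle a) • dir a

/-- The unit tangent vector of the arc `a` at its head, pointing into the arc. -/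
def SphericalFramework.headDir {H : Type*} [NormedAddCommGroup H] [InnerProductSpace ℝ H]
    {V A : Type*} (S : SphericalFramework H V A) (a : A) : H :=
  Real.sin (S.angle a) • S.pos (S.tail a) - Real.cos (S.angle a) • S.dir a

/-- There is a non-zero stress on the arcs such that at each vertex the weighted sum of the unit
tangents of the arcs emanating from it vanishes. -/
def SphericalFramework.SelfStressable {H : Type*} [NormedAddCommGroup H] [InnerProductSpace ℝ H]
    {V A : Type*} (S : SphericalFramework H V A) : Prop :=
  ∃ w : A → ℝ, w ≠ 0 ∧ ∀ u : V,
    (∑ᶠ a : {a : A // S.tail a = u}, w a.1 • S.dir a.1)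
      + (∑ᶠ a : {a : A // S.head a = u}, w a.1 • S.headDir a.1) = 0

variable {X : Type u} [TopologicalSpace X] {C : Set X} [Topology.CWComplex C] {d : ℕ}

/-- The spherical framework `S_v` of a `d`-vertex `v`, in the unit sphere of the 3-dimensional
space `h` orthogonal to the plane of `v`. Its vertices are the `d`-edges `e` incident to `v`, placed
at a point where the projection to `h` of the plane of `e` meets the sphere; its arcs are the
`d`-faces `f` incident to `v`, each drawn on the great circle cut out by the projection of the
plane of `f` and joining the two `d`-edges of `f` at `v`. -/
structure LocalFramework (R : RFramework C d) (v : DVertex C d) extends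
    SphericalFramework (R.dir v.1)ᗮ {e : Edge C d // v.1 < e.1} {f : Face C d // v.1 < f.1} where
  pos_mem : ∀ e, (pos e : EuclideanSpace ℝ (Fin (d + 1))) ∈ R.dir e.1.1
  dir_mem : ∀ f, (dir f : EuclideanSpace ℝ (Fin (d + 1))) ∈ R.dir f.1.1
  tail_ne_head : ∀ f, tail f ≠ head f
  ends : ∀ f e, e.1.1 < f.1.1 ↔ e = tail f ∨ e = head f

end Spherical

end RFw

end

/-!
Let `M` be the complex, and write multiplicative quantities additively. At each edge `e` the three
normals are pairwise independent vectors of the plane orthogonal to `e`, so they satisfy a single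
linear relation up to a factor, and its coefficients `c e f` do not vanish
(`Normals.exists_isCoefficients`). A nowhere vanishing stress is in equilibrium at `e` exactly if it
differs from `c e` by a constant, so a self-stress amounts to a potential for `c`: a function `φ` on
faces and edges with `c e f = φ f - φ e`. The logarithm of the inverse of the stress monodromy of a
face-cycle is the alternating sum of `c` along it.

* A potential exists as soon as the sum of `c` vanishes on all face-loops
  (`exists_potential_of_loops`). This is a statement about the bipartite graph of incidences: a
  simple path from a face to an edge, closed up by one further incidence, is a face-loop. It gives
  the criterion by face-loops.
* The spherical framework of `v` is self-stressable exactly if `c` has a potential around `v`.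
  The tangents of its arcs are multiples of the normals `n(e, f)`; comparing determinants and using
  that the incidence numbers around the diamond from `v` to `f` cancel, the factors split into a
  factor for `e` and a factor for `f` (`LocalFramework.exists_factors`).
* If this holds at all `v`, then `c` extends to a 1-cocycle `w` on the poset of cells, that is,
  `w(x, z) = w(x, y) + w(y, z)` for `x < y < z` (`exists_cocycle_of_local`). The extension goes down
  in dimension: on the link of `x` the cocycle already constructed has a potential, because the link
  is connected with trivial first homology, and this potential is taken for `w(x, ·)`.
* The cocycle `w` is a homomorphism on 1-cycles modulo boundaries. If it vanishes on face-cycles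
  generating `H₁`, it vanishes on all face-loops, and a self-stress exists. If `M` is simply
  connected, the covering space defined by `w` has no monodromy, which again yields a potential
  (`IsRegular.exists_potential_of_simplyConnected`).
* That face-cycles generate `H₁` is the same argument with other coefficients: the tautological
  cocycle with values in the 1-chains modulo boundaries and face-cycles has a potential on the top
  two dimensions, which extends to all cells since links are connected, so every 1-cycle is a sum of
  a boundary and of face-cycles (`span_homologyClass_eq_top`).
-/

noncomputable section

namespace RFw

open scoped RealInnerProductSpace

universe u

/-! ### The face poset of a regular CW-complex -/

section CellPoset

open Topology

variable {X : Type u} [TopologicalSpace X] {C : Set X} [CWComplex C]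

/-- The open cell, as a subset of the ambient space. -/
def Cell.interior (x : Cell C) : Set X := RelCWComplex.openCell x.dim x.idx

/-- The characteristic map of a cell, defined on the unit ball of `Fin x.dim → ℝ`. -/
def Cell.charMap (x : Cell C) : (Fin x.dim → ℝ) → X := RelCWComplex.map x.dim x.idx

/-- A point in the open cell. -/
def Cell.center (x : Cell C) : X := x.charMap 0

theorem Cell.center_mem_interior (x : Cell C) : x.center ∈ x.interior :=
  RelCWComplex.map_zero_mem_openCell _ _

theorem Cell.interior_subset (x : Cell C) : x.interior ⊆ x.carrier :=
  RelCWComplex.openCell_subset_closedCell _ _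

theorem Cell.carrier_subset (x : Cell C) : x.carrier ⊆ C :=
  RelCWComplex.closedCell_subset_complex _ _

theorem Cell.eq_of_mem_interior {x y : Cell C} {q : X} (hx : q ∈ x.interior)
    (hy : q ∈ y.interior) : x = y := by
  obtain ⟨n, i⟩ := x
  obtain ⟨m, j⟩ := y
  have h : (⟨n, i⟩ : Σ n, RelCWComplex.cell C n) = ⟨m, j⟩ :=
    RelCWComplex.eq_of_not_disjoint_openCell (Set.not_disjoint_iff.2 ⟨q, hx, hy⟩)
  cases h
  rfl

theorem Cell.exists_mem_interior {q : X} (hq : q ∈ C) : ∃ x : Cell C, q ∈ x.interior := by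
  rw [← CWComplex.iUnion_openCell_eq_complex (C := C)] at hq
  simp only [Set.mem_iUnion] at hq
  obtain ⟨n, i, h⟩ := hq
  exact ⟨⟨n, i⟩, h⟩

/-- A point of the boundary of a cell lies in the interior of a cell of smaller dimension. -/
theorem Cell.dim_lt_of_mem_frontier {x y : Cell C} {q : X}
    (hx : q ∈ RelCWComplex.cellFrontier x.dim x.idx) (hy : q ∈ y.interior) : y.dim < x.dim := by
  obtain ⟨I, hI⟩ := CWComplex.cellFrontier_subset_finite_openCell x.dim x.idx
  have := hI hx
  simp only [Set.mem_iUnion] at this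
  obtain ⟨m, hm, j, -, hj⟩ := this
  have h := Cell.eq_of_mem_interior (x := ⟨m, j⟩) hj hy
  rw [← h]
  exact hm

theorem Cell.mem_interior_or_dim_lt {x y : Cell C} {q : X} (hx : q ∈ x.carrier)
    (hy : q ∈ y.interior) : y = x ∨ y.dim < x.dim := by
  have h : q ∈ RelCWComplex.cellFrontier x.dim x.idx ∪ x.interior := by
    have := RelCWComplex.cellFrontier_union_openCell_eq_closedCell x.dim x.idx
    rw [Cell.interior, this]
    exact hx
  rcases h with h | h
  · exact Or.inr (Cell.dim_lt_of_mem_frontier h hy)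
  · exact Or.inl (Cell.eq_of_mem_interior hy h)

theorem Cell.eq_or_dim_lt_of_le {x y : Cell C} (h : x ≤ y) : x = y ∨ x.dim < y.dim :=
  Cell.mem_interior_or_dim_lt (h (x.interior_subset x.center_mem_interior)) x.center_mem_interior

theorem Cell.dim_lt_dim {x y : Cell C} (h : x < y) : x.dim < y.dim := by
  rcases Cell.eq_or_dim_lt_of_le h.le with rfl | h'
  · exact absurd h (lt_irrefl _)
  · exact h'

theorem Cell.eq_or_lt_of_le {x y : Cell C} (h : x ≤ y) : x = y ∨ x < y := by
  rcases Cell.eq_or_dim_lt_of_le h with h' | h'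
  · exact Or.inl h'
  · refine Or.inr (lt_of_le_not_ge h fun h2 => ?_)
    rcases Cell.eq_or_dim_lt_of_le h2 with rfl | h3
    · exact lt_irrefl _ h'
    · exact lt_asymm h' h3

theorem finite_cell [RelCWComplex.Finite C] : Finite (Cell C) := by
  have := RelCWComplex.finite_cells_of_finite (C := C)
  refine Finite.of_injective (fun x : Cell C => (⟨x.dim, x.idx⟩ : Σ n, RelCWComplex.cell C n)) ?_
  rintro ⟨n, i⟩ ⟨m, j⟩ h
  cases h
  rfl

/-- In a regular complex a closed cell is a union of open cells. -/
theorem IsRegular.le_of_mem_interior [T2Space X] (hreg : IsRegular C) {x y : Cell C} {q : X}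
    (hx : q ∈ x.interior) (hy : q ∈ y.carrier) : x ≤ y := by
  have h : q ∈ RelCWComplex.cellFrontier y.dim y.idx ∪ y.interior := by
    have := RelCWComplex.cellFrontier_union_openCell_eq_closedCell y.dim y.idx
    rw [Cell.interior, this]
    exact hy
  rcases h with h | h
  · obtain ⟨A, hA⟩ := hreg.frontier y.dim y.idx
    have hq : q ∈ (A : Set X) := hA ▸ h
    rw [← CWComplex.Subcomplex.union] at hq
    simp only [Set.mem_iUnion] at hq
    obtain ⟨m, j, hj⟩ := hq
    have hxj : (⟨m, j.1⟩ : Cell C) = x := Cell.eq_of_mem_interior hj hx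
    have h1 : RelCWComplex.closedCell m j.1 ⊆ (A : Set X) :=
      RelCWComplex.Subcomplex.closedCell_subset_of_mem A j.2
    rw [← hxj]
    exact (h1.trans hA.subset).trans (RelCWComplex.cellFrontier_subset_closedCell _ _)
  · rw [Cell.eq_of_mem_interior hx h]

end CellPoset

/-! ### Cocycles and potentials on the order complex -/

section Cocycles

variable {P : Type u} [Preorder P] {A : Type*} [AddCommGroup A]

/-- A function on the pairs `a < b` of a poset, with values in an abelian group, evaluated on the
1-chains of the order complex. -/
def evalChain (w : P → P → A) : Chain1 P →ₗ[ℤ] A :=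
  Finsupp.linearCombination ℤ fun s => w s.1.1 s.1.2

theorem evalChain_single (w : P → P → A) {a b : P} (h : a < b) (n : ℤ) :
    evalChain w (Finsupp.single ⟨(a, b), h⟩ n) = n • w a b := by
  simp [evalChain]

theorem bd1_single {a b : P} (h : a < b) (n : ℤ) :
    bd1 P (Finsupp.single ⟨(a, b), h⟩ n) = Finsupp.single b n - Finsupp.single a n := by
  simp [bd1, smul_sub]

/-- A 1-cocycle vanishes on boundaries. -/
theorem evalChain_bd2 {w : P → P → A}
    (hw : ∀ a b c, a < b → b < c → w a c = w a b + w b c) (z : Chain2 P) :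
    evalChain w (bd2 P z) = 0 := by
  have : evalChain w ∘ₗ bd2 P = 0 := by
    refine Finsupp.lhom_ext fun t n => ?_
    obtain ⟨⟨a, b, c⟩, hab, hbc⟩ := t
    simp only [LinearMap.comp_apply, bd2, Finsupp.linearCombination_single, map_smul, map_add,
      map_sub, evalChain_single, LinearMap.zero_apply]
    rw [hw a b c hab hbc]
    simp
  exact LinearMap.congr_fun this z

/-- On a connected poset, a function on pairs that vanishes on all 1-cycles is the coboundary of
a function on points. -/
theorem exists_potential_of_evalChain_eq_zero
    (hle : ∀ a b : P, a ≤ b → a = b ∨ a < b)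
    (hconn : ∀ y z : P, Relation.EqvGen (fun a b => a ≤ b) y z) {w : P → P → A}
    (hw : ∀ z, bd1 P z = 0 → evalChain w z = 0) :
    ∃ g : P → A, ∀ a b, a < b → w a b = g b - g a := by
  rcases isEmpty_or_nonempty P with hP | ⟨⟨y₀⟩⟩
  · exact ⟨fun _ => 0, fun a => hP.elim a⟩
  have key : ∀ y z : P, Relation.EqvGen (fun a b => a ≤ b) y z →
      ∃ c : Chain1 P, bd1 P c = Finsupp.single z 1 - Finsupp.single y 1 := by
    intro y z h
    induction h with
    | rel a b h =>
      rcases hle a b h with rfl | h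
      · exact ⟨0, by simp⟩
      · exact ⟨Finsupp.single ⟨(a, b), h⟩ 1, bd1_single h 1⟩
    | refl a => exact ⟨0, by simp⟩
    | symm a b _ ih =>
      obtain ⟨c, hc⟩ := ih
      exact ⟨-c, by rw [map_neg, hc, neg_sub]⟩
    | trans a b c _ _ ih1 ih2 =>
      obtain ⟨c1, h1⟩ := ih1
      obtain ⟨c2, h2⟩ := ih2
      exact ⟨c1 + c2, by rw [map_add, h1, h2]; abel⟩
  choose c hc using fun y => key y₀ y (hconn y₀ y)
  refine ⟨fun y => evalChain w (c y), fun a b h => ?_⟩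
  have := hw (Finsupp.single ⟨(a, b), h⟩ 1 + c a - c b) (by
    rw [map_sub, map_add, hc, hc, bd1_single]; abel)
  rw [map_sub, map_add, evalChain_single, one_smul] at this
  rw [eq_sub_iff_add_eq, ← sub_eq_zero, this]

/-- A linear function on cycles that vanishes on boundaries and on cycles generating the first
homology group vanishes on all cycles. -/
theorem evalChain_eq_zero_of_span {w : P → P → A}
    (hw : ∀ a b c, a < b → b < c → w a c = w a b + w b c) {ι : Type*}
    (z : ι → LinearMap.ker (bd1 P))
    (hspan : Submodule.span ℤ (Set.range fun i => (Submodule.Quotient.mk (z i) : H1 P)) = ⊤)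
    (hz : ∀ i, evalChain w (z i) = 0) (y : Chain1 P) (hy : bd1 P y = 0) :
    evalChain w y = 0 := by
  let F : H1 P →ₗ[ℤ] A :=
    Submodule.liftQ _ (evalChain w ∘ₗ (LinearMap.ker (bd1 P)).subtype) (by
      intro x hx
      obtain ⟨t, ht⟩ := hx
      rw [LinearMap.mem_ker, LinearMap.comp_apply]
      rw [← ht]
      exact evalChain_bd2 hw t)
  have hF : F = 0 := by
    refine LinearMap.ext_on_range (v := fun i => (Submodule.Quotient.mk (z i) : H1 P)) hspan ?_
    intro i
    exact hz i
  have := LinearMap.congr_fun hF (Submodule.Quotient.mk ⟨y, hy⟩)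
  exact this

theorem exists_potential_of_subsingleton_H1 (hle : ∀ a b : P, a ≤ b → a = b ∨ a < b)
    (hconn : ∀ y z : P, Relation.EqvGen (fun a b => a ≤ b) y z) (hH : Subsingleton (H1 P))
    {w : P → P → A} (hw : ∀ a b c, a < b → b < c → w a c = w a b + w b c) :
    ∃ g : P → A, ∀ a b, a < b → w a b = g b - g a := by
  refine exists_potential_of_evalChain_eq_zero hle hconn fun z hz => ?_
  exact evalChain_eq_zero_of_span hw (ι := Empty) Empty.elim (Subsingleton.elim _ _)
    (fun i => i.elim) z hz

end Cocycles

/-! ### Gains on the incidences of faces and edges -/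

section Gains

variable {X : Type u} [TopologicalSpace X] {C : Set X} [Topology.CWComplex C] {d : ℕ}
  {A : Type*} [AddCommGroup A]

/-- The total gain along a face-path of a function `c` on the incidences of edges and faces:
at each edge the path leaves one face and enters another. -/
def FacePath.gain (γ : FacePath C d) (c : Edge C d → Face C d → A) : A :=
  ∑ i : Fin γ.length, (c (γ.edge i) (γ.face i.succ) - c (γ.edge i) (γ.face i.castSucc))

theorem FacePath.evalChain_chain (γ : FacePath C d) (w : Cell C → Cell C → A) :
    evalChain w γ.chain = γ.gain fun e f => w e.1 f.1 := by
  simp [FacePath.chain, FacePath.gain, map_sum, map_sub, evalChain_single]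

/-- The bipartite graph on faces and edges spanned by a set of incidences. -/
def incidenceGraph (B : Set (Edge C d × Face C d)) : SimpleGraph (Face C d ⊕ Edge C d) :=
  SimpleGraph.fromRel fun a b => ∃ e f, (e, f) ∈ B ∧ a = Sum.inl f ∧ b = Sum.inr e

theorem incidenceGraph_adj_inl {B : Set (Edge C d × Face C d)} {f : Face C d}
    {b : Face C d ⊕ Edge C d} (h : (incidenceGraph B).Adj (Sum.inl f) b) :
    ∃ e, (e, f) ∈ B ∧ b = Sum.inr e := by
  simp only [incidenceGraph, SimpleGraph.fromRel_adj] at h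
  obtain ⟨-, ⟨e, f', h, h1, h2⟩ | ⟨e, f', h, h1, h2⟩⟩ := h
  · cases h1
    exact ⟨e, h, h2⟩
  · cases h2

theorem incidenceGraph_adj_inr {B : Set (Edge C d × Face C d)} {e : Edge C d}
    {b : Face C d ⊕ Edge C d} (h : (incidenceGraph B).Adj (Sum.inr e) b) :
    ∃ f, (e, f) ∈ B ∧ b = Sum.inl f := by
  simp only [incidenceGraph, SimpleGraph.fromRel_adj] at h
  obtain ⟨-, ⟨e', f', h, h1, h2⟩ | ⟨e', f', h, h1, h2⟩⟩ := h
  · cases h1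
  · cases h2
    exact ⟨f', h, h1⟩

theorem incidenceGraph_adj {B : Set (Edge C d × Face C d)} {e : Edge C d} {f : Face C d}
    (h : (e, f) ∈ B) : (incidenceGraph B).Adj (Sum.inl f) (Sum.inr e) := by
  rw [incidenceGraph, SimpleGraph.fromRel_adj]
  exact ⟨by simp, Or.inl ⟨e, f, h, rfl, rfl⟩⟩

/-- A walk starting in a face is at a face after an even number of steps. -/
theorem exists_getVert_even {B : Set (Edge C d × Face C d)} {f : Face C d}
    {b : Face C d ⊕ Edge C d} (p : (incidenceGraph B).Walk (Sum.inl f) b) (i : ℕ)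
    (hi : 2 * i ≤ p.length) : ∃ f', p.getVert (2 * i) = Sum.inl f' := by
  induction i with
  | zero => exact ⟨f, by simp⟩
  | succ i ih =>
    obtain ⟨f', h⟩ := ih (by omega)
    have h1 := p.adj_getVert_succ (i := 2 * i) (by omega)
    rw [h] at h1
    obtain ⟨e, -, h2⟩ := incidenceGraph_adj_inl h1
    have h3 := p.adj_getVert_succ (i := 2 * i + 1) (by omega)
    rw [h2] at h3
    obtain ⟨f'', -, h4⟩ := incidenceGraph_adj_inr h3
    exact ⟨f'', h4⟩

/-- A simple path in the incidence graph from a face `f` to an edge `e`, closed up by the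
incidence of `e` and `f`, is a face-loop. If a potential for the gains exists along the path, and
the gain of the face-loop vanishes, then the potential also fits the closing incidence. -/
theorem gain_eq_of_isPath {c : Edge C d → Face C d → A}
    (hc : ∀ γ : FaceCycle C d, γ.IsLoop → γ.gain c = 0)
    {B : Set (Edge C d × Face C d)} (hB : ∀ x ∈ B, x.1.1 < x.2.1)
    {φ : Face C d ⊕ Edge C d → A}
    (hφ : ∀ x ∈ B, c x.1 x.2 = φ (Sum.inl x.2) - φ (Sum.inr x.1))
    {e : Edge C d} {f : Face C d} (hef : e.1 < f.1)
    (p : (incidenceGraph B).Walk (Sum.inl f) (Sum.inr e)) (hp : p.IsPath) :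
    c e f = φ (Sum.inl f) - φ (Sum.inr e) := by
  -- The path has odd length `2 * k + 1`.
  obtain ⟨k, hk⟩ : ∃ k, p.length = 2 * k + 1 := by
    rcases Nat.even_or_odd' p.length with ⟨k, hk | hk⟩
    · obtain ⟨f', h⟩ := exists_getVert_even p k hk.ge
      rw [← hk, p.getVert_length] at h
      cases h
    · exact ⟨k, hk⟩
  -- The faces `F i` and the edges `E i` of the path, for `i ≤ k`; the other values do not matter.
  have hF : ∀ i, ∃ f', i ≤ k → p.getVert (2 * i) = Sum.inl f' := by
    intro i
    by_cases hi : i ≤ k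
    · obtain ⟨f', h⟩ := exists_getVert_even p i (by omega)
      exact ⟨f', fun _ => h⟩
    · exact ⟨f, fun h => absurd h hi⟩
  choose F hF using hF
  have hE : ∀ i, ∃ e', i ≤ k → (e', F i) ∈ B ∧ p.getVert (2 * i + 1) = Sum.inr e' := by
    intro i
    by_cases hi : i ≤ k
    · have h1 := p.adj_getVert_succ (i := 2 * i) (by omega)
      rw [hF i hi] at h1
      obtain ⟨e', h2, h3⟩ := incidenceGraph_adj_inl h1
      exact ⟨e', fun _ => ⟨h2, h3⟩⟩
    · exact ⟨e, fun h => absurd h hi⟩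
  choose E hE using hE
  have hnext : ∀ i, i < k → (E i, F (i + 1)) ∈ B := by
    intro i hi
    have h1 := p.adj_getVert_succ (i := 2 * i + 1) (by omega)
    rw [(hE i hi.le).2] at h1
    obtain ⟨f', h2, h3⟩ := incidenceGraph_adj_inr h1
    have h4 := hF (i + 1) (by omega)
    rw [show 2 * (i + 1) = 2 * i + 1 + 1 by ring, h3] at h4
    cases h4
    exact h2
  have hF0 : F 0 = f := by
    have := hF 0 (Nat.zero_le _)
    simp only [Nat.mul_zero, SimpleGraph.Walk.getVert_zero] at this
    cases this
    rfl
  have hEk : E k = e := by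
    have := (hE k le_rfl).2
    rw [← hk, p.getVert_length] at this
    cases this
    rfl
  have hinj : ∀ i j, i ≤ 2 * k + 1 → j ≤ 2 * k + 1 → p.getVert i = p.getVert j → i = j := by
    intro i j hi hj h
    exact hp.getVert_injOn (by simpa [hk] using hi) (by simpa [hk] using hj) h
  have hFinj : ∀ i j, i ≤ k → j ≤ k → F i = F j → i = j := by
    intro i j hi hj h
    have := hinj (2 * i) (2 * j) (by omega) (by omega) (by rw [hF i hi, hF j hj, h])
    omega
  have hEinj : ∀ i j, i ≤ k → j ≤ k → E i = E j → i = j := by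
    intro i j hi hj h
    have := hinj (2 * i + 1) (2 * j + 1) (by omega) (by omega)
      (by rw [(hE i hi).2, (hE j hj).2, h])
    omega
  rcases Nat.eq_zero_or_pos k with hk0 | hkpos
  · subst hk0
    have := hφ _ (hE 0 le_rfl).1
    rwa [hF0, hEk] at this
  -- The faces of the loop, the first one repeated at the end.
  let F' : ℕ → Face C d := fun i => if i = k + 1 then f else F i
  have hF'lt : ∀ i, i ≤ k → F' i = F i := fun i hi => if_neg (by omega)
  have hF'last : F' (k + 1) = f := if_pos rfl
  let γ : FaceCycle C d :=
    { length := k + 1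
      face := fun i => F' i
      edge := fun i => E i
      left := fun i => by
        have hi := i.2
        rw [Fin.val_castSucc, hF'lt i (by omega)]
        exact hB _ (hE i (by omega)).1
      right := fun i => by
        rw [Fin.val_succ]
        rcases Nat.lt_succ_iff_lt_or_eq.1 i.2 with hi | hi
        · rw [hF'lt _ (by omega)]
          exact hB _ (hnext i hi)
        · rw [hi, hF'last, hEk]
          exact hef
      ne := fun i => by
        rw [Fin.val_succ, Fin.val_castSucc]
        rcases Nat.lt_succ_iff_lt_or_eq.1 i.2 with hi | hi
        · rw [hF'lt _ (by omega), hF'lt _ (by omega)]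
          intro h
          have := hFinj _ _ (by omega) (by omega) h
          omega
        · rw [hi, hF'last, hF'lt _ le_rfl, ← hF0]
          intro h
          have := hFinj _ _ (by omega) (by omega) h
          omega
      edge_injective := fun i j h => by
        have hi := i.2
        have hj := j.2
        exact Fin.ext (hEinj _ _ (by omega) (by omega) h)
      closed := by
        rw [Fin.val_last, hF'last, Fin.val_zero, hF'lt 0 (Nat.zero_le _), hF0] }
  have hloop : γ.IsLoop := by
    intro i j h
    have hi : i.1 < k + 1 := i.2
    have hj : j.1 < k + 1 := j.2
    have h' : F' i.1 = F' j.1 := h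
    rw [hF'lt i.1 (by omega), hF'lt j.1 (by omega)] at h'
    exact Fin.ext (hFinj _ _ (by omega) (by omega) h')
  have hsum := hc γ hloop
  -- On all incidences but the closing one, `c` is the coboundary of `φ`, so the sum telescopes up to
  -- the defect at the closing incidence.
  have hterm : γ.gain c = ∑ i : Fin (k + 1), ((φ (Sum.inl (F' i.succ.1)) -
      φ (Sum.inl (F' i.castSucc.1))) +
        if i = Fin.last k then c e f - (φ (Sum.inl f) - φ (Sum.inr e)) else 0) := by
    refine Finset.sum_congr rfl fun i _ => ?_
    change c (E i) (F' i.succ.1) - c (E i) (F' i.castSucc.1) = _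
    have h1 : c (E i) (F' i.castSucc.1) = φ (Sum.inl (F' i.castSucc.1)) - φ (Sum.inr (E i)) := by
      have hi : i.1 < k + 1 := i.2
      rw [Fin.val_castSucc, hF'lt i (by omega)]
      exact hφ _ (hE i (by omega)).1
    rw [h1]
    by_cases hi : i = Fin.last k
    · subst hi
      rw [if_pos rfl, Fin.val_succ, Fin.val_last, hF'last, hEk]
      abel
    · rw [if_neg hi]
      have hi' : i.1 < k := by
        have h2 : i.1 < k + 1 := i.2
        have h3 : i.1 ≠ k := fun h => hi (Fin.ext h)
        omega
      have h2 : c (E i) (F' i.succ.1) = φ (Sum.inl (F' i.succ.1)) - φ (Sum.inr (E i)) := by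
        rw [Fin.val_succ, hF'lt _ (by omega)]
        exact hφ _ (hnext i hi')
      rw [h2]
      abel
  rw [hterm, Finset.sum_add_distrib,
    sum_fin_sub (k + 1) (fun i => φ (Sum.inl (F' i.1)))] at hsum
  simp only [Fin.val_last, Fin.val_zero, hF'last, hF'lt 0 (Nat.zero_le _), hF0, sub_self, zero_add,
    Finset.sum_ite_eq', Finset.mem_univ, if_true] at hsum
  exact sub_eq_zero.1 hsum

/-- If the gains of all face-loops vanish, the gains are the coboundary of a potential on faces and
edges. The incidences are added one at a time: an incidence joining two components of the incidence
graph is accommodated by shifting the potential on one of them, any other incidence closes up a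
face-loop. -/
theorem exists_potential_of_loops [Finite (Cell C)] {c : Edge C d → Face C d → A}
    (hc : ∀ γ : FaceCycle C d, γ.IsLoop → γ.gain c = 0) :
    ∃ φ : Face C d ⊕ Edge C d → A,
      ∀ e f, e.1 < f.1 → c e f = φ (Sum.inl f) - φ (Sum.inr e) := by
  classical
  have key : ∀ B : Set (Edge C d × Face C d), B.Finite → (∀ x ∈ B, x.1.1 < x.2.1) →
      ∃ φ : Face C d ⊕ Edge C d → A, ∀ x ∈ B, c x.1 x.2 = φ (Sum.inl x.2) - φ (Sum.inr x.1) := by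
    intro B hfin
    induction B, hfin using Set.Finite.induction_on with
    | empty => exact fun _ => ⟨fun _ => 0, fun x hx => absurd hx (Set.notMem_empty x)⟩
    | @insert x B _ _ ih =>
      intro hB
      obtain ⟨e, f⟩ := x
      have hef : e.1 < f.1 := hB (e, f) (Set.mem_insert _ _)
      have hB' : ∀ x ∈ B, x.1.1 < x.2.1 := fun x hx => hB x (Set.mem_insert_of_mem _ hx)
      obtain ⟨φ, hφ⟩ := ih hB'
      by_cases hr : (incidenceGraph B).Reachable (Sum.inl f) (Sum.inr e)
      · obtain ⟨p, hp⟩ := hr.exists_isPath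
        refine ⟨φ, fun x hx => ?_⟩
        rcases Set.mem_insert_iff.1 hx with rfl | hx
        · exact gain_eq_of_isPath hc hB' hφ hef p hp
        · exact hφ x hx
      · refine ⟨fun v => if (incidenceGraph B).Reachable (Sum.inl f) v then
          φ v + (c e f - (φ (Sum.inl f) - φ (Sum.inr e))) else φ v, fun x hx => ?_⟩
        rcases Set.mem_insert_iff.1 hx with rfl | hx
        · dsimp only
          rw [if_pos (SimpleGraph.Reachable.refl _), if_neg hr]
          abel
        · have hadj := incidenceGraph_adj (B := B) (e := x.1) (f := x.2) hx
          have hiff : (incidenceGraph B).Reachable (Sum.inl f) (Sum.inl x.2) ↔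
              (incidenceGraph B).Reachable (Sum.inl f) (Sum.inr x.1) :=
            ⟨fun h => h.trans hadj.reachable, fun h => h.trans hadj.symm.reachable⟩
          rw [hφ x hx]
          dsimp only
          by_cases h : (incidenceGraph B).Reachable (Sum.inl f) (Sum.inl x.2)
          · rw [if_pos h, if_pos (hiff.1 h)]
            abel
          · rw [if_neg h, if_neg (fun h' => h (hiff.2 h'))]
  obtain ⟨φ, hφ⟩ := key {x | x.1.1 < x.2.1} (Set.toFinite _) fun x hx => hx
  exact ⟨φ, fun e f h => hφ (e, f) h⟩

/-! ### From the top two dimensions to the whole complex -/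

/-- A cocycle that is a coboundary on the cells of the top two dimensions is a coboundary, if the
links of the smaller cells are non-empty and connected: the potential at a cell is determined by
the potential at any cell above it. -/
theorem exists_potential_of_top {w : Cell C → Cell C → A}
    (hw : ∀ a b c, a < b → b < c → w a c = w a b + w b c)
    (hdim : ∀ x : Cell C, x.dim ≤ d)
    (hlink : ∀ x : Cell C, x.dim + 2 ≤ d →
      Nonempty (Set.Ioi x) ∧ ∀ y z : Set.Ioi x, Relation.EqvGen (fun a b => a ≤ b) y z)
    {φ : Face C d ⊕ Edge C d → A}
    (hφ : ∀ (e : Edge C d) (f : Face C d), e.1 < f.1 →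
      w e.1 f.1 = φ (Sum.inl f) - φ (Sum.inr e)) :
    ∃ g : Cell C → A, ∀ a b, a < b → w a b = g b - g a := by
  classical
  -- Downward induction on the dimension `k`, starting at `d - 1`.
  have key : ∀ j k, k + j + 1 = d → ∃ g : Cell C → A, ∀ a b, a < b → k ≤ a.dim →
      w a b = g b - g a := by
    intro j
    induction j with
    | zero =>
      intro k hk
      refine ⟨fun x => if h : x.dim = d then φ (Sum.inl ⟨x, h⟩) else
        if h : x.dim + 1 = d then φ (Sum.inr ⟨x, h⟩) else 0, fun a b hab ha => ?_⟩
      have h1 := Cell.dim_lt_dim hab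
      have h2 := hdim b
      have hb : b.dim = d := by omega
      have ha' : ¬ a.dim = d := by omega
      have ha'' : a.dim + 1 = d := by omega
      simp only [dif_pos hb, dif_neg ha', dif_pos ha'']
      exact hφ ⟨a, ha''⟩ ⟨b, hb⟩ hab
    | succ j ih =>
      intro k hk
      obtain ⟨g, hg⟩ := ih (k + 1) (by omega)
      have hconst : ∀ x : Cell C, ∃ t : A, x.dim = k → ∀ y, x < y → g y - w x y = t := by
        intro x
        by_cases hx : x.dim = k
        · obtain ⟨⟨y₀⟩, hconn⟩ := hlink x (by omega)
          refine ⟨g y₀ - w x y₀, fun _ y hy => ?_⟩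
          have : ∀ a b : Set.Ioi x, Relation.EqvGen (fun a b => a ≤ b) a b →
              g a - w x a = g b - w x b := by
            intro a b h
            induction h with
            | rel a b h =>
              rcases Cell.eq_or_lt_of_le (x := a.1) (y := b.1) h with h | h
              · rw [h]
              · rw [hw x a b a.2 h, hg a b h (by have := Cell.dim_lt_dim a.2; omega)]
                abel
            | refl a => rfl
            | symm a b _ ih => exact ih.symm
            | trans a b c _ _ ih1 ih2 => exact ih1.trans ih2
          exact this ⟨y, hy⟩ y₀ (hconn _ _)
        · exact ⟨0, fun h => absurd h hx⟩
      choose t ht using hconst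
      refine ⟨fun x => if x.dim = k then t x else g x, fun a b hab ha => ?_⟩
      have h1 := Cell.dim_lt_dim hab
      have hb : ¬ b.dim = k := by omega
      by_cases hak : a.dim = k
      · simp only [if_neg hb, if_pos hak, ← ht a hak b hab]
        abel
      · simp only [if_neg hb, if_neg hak]
        exact hg a b hab (by omega)
  rcases Nat.eq_zero_or_pos d with hd | hd
  · refine ⟨fun _ => 0, fun a b hab => ?_⟩
    have := Cell.dim_lt_dim hab
    have := hdim b
    omega
  · obtain ⟨g, hg⟩ := key (d - 1) 0 (by omega)
    exact ⟨g, fun a b hab => hg a b hab (Nat.zero_le _)⟩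

/-- Gains on the incidences of the top two dimensions extend to a cocycle on the whole complex, if
they are coboundaries in the links of the `(d-2)`-cells and the links of the smaller cells are
connected with trivial first homology. On the pairs `x < y` with `x` fixed, the cocycle is a
potential for its restriction to the link of `x`. -/
theorem exists_cocycle_of_local {c : Edge C d → Face C d → A}
    (hdim : ∀ x : Cell C, x.dim ≤ d) (hlink : LinkCondition C d)
    (hloc : ∀ v : DVertex C d, ∃ φ : Face C d ⊕ Edge C d → A,
      ∀ e f, v.1 < e.1 → e.1 < f.1 → c e f = φ (Sum.inl f) - φ (Sum.inr e)) :
    ∃ w : Cell C → Cell C → A, (∀ a b c, a < b → b < c → w a c = w a b + w b c) ∧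
      ∀ (e : Edge C d) (f : Face C d), e.1 < f.1 → w e.1 f.1 = c e f := by
  classical
  -- Downward induction on the dimension `k`, starting at `d - 1`.
  have key : ∀ j k, k + j + 1 = d → ∃ w : Cell C → Cell C → A,
      (∀ a b c, a < b → b < c → k ≤ a.dim → w a c = w a b + w b c) ∧
      ∀ (e : Edge C d) (f : Face C d), e.1 < f.1 → w e.1 f.1 = c e f := by
    intro j
    induction j with
    | zero =>
      intro k hk
      refine ⟨fun a b => if h : a.dim + 1 = d ∧ b.dim = d then c ⟨a, h.1⟩ ⟨b, h.2⟩ else 0,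
        fun x y z hxy hyz hx => ?_, fun e f hef => dif_pos ⟨e.2, f.2⟩⟩
      have h1 := Cell.dim_lt_dim hxy
      have h2 := Cell.dim_lt_dim hyz
      have h3 := hdim z
      omega
    | succ j ih =>
      intro k hk
      obtain ⟨w, hw, hwc⟩ := ih (k + 1) (by omega)
      have hpot : ∀ x : Cell C, ∃ g : Cell C → A, x.dim = k →
          ∀ a b, x < a → a < b → w a b = g b - g a := by
        intro x
        by_cases hx : x.dim = k
        · by_cases hj : j = 0
          -- If `j = 0`, then `x` is a `(d-2)`-cell.
          · obtain ⟨φ, hφ⟩ := hloc ⟨x, by omega⟩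
            refine ⟨fun x => if h : x.dim = d then φ (Sum.inl ⟨x, h⟩) else
              if h : x.dim + 1 = d then φ (Sum.inr ⟨x, h⟩) else 0, fun _ a b ha hab => ?_⟩
            have h0 := Cell.dim_lt_dim ha
            have h1 := Cell.dim_lt_dim hab
            have h2 := hdim b
            have hb : b.dim = d := by omega
            have ha' : ¬ a.dim = d := by omega
            have ha'' : a.dim + 1 = d := by omega
            simp only [dif_pos hb, dif_neg ha', dif_pos ha'']
            exact (hwc ⟨a, ha''⟩ ⟨b, hb⟩ hab).trans (hφ ⟨a, ha''⟩ ⟨b, hb⟩ ha hab)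
          · obtain ⟨g, hg⟩ := exists_potential_of_subsingleton_H1 (P := Set.Ioi x)
              (w := fun a b => w a.1 b.1)
              (fun a b h => (Cell.eq_or_lt_of_le (x := a.1) (y := b.1) h).imp Subtype.ext id)
              (hlink.1 x (by omega)).2 (hlink.2 x (by omega))
              (fun a b c hab hbc => hw a b c hab hbc (by
                have := Cell.dim_lt_dim a.2
                omega))
            refine ⟨fun y => if h : x < y then g ⟨y, h⟩ else 0, fun _ a b ha hab => ?_⟩
            refine Eq.trans ?_ (congrArg₂ (· - ·) (dif_pos (ha.trans hab)) (dif_pos ha)).symm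
            exact hg ⟨a, ha⟩ ⟨b, ha.trans hab⟩ hab
        · exact ⟨fun _ => 0, fun h => absurd h hx⟩
      choose g hg using hpot
      refine ⟨fun a b => if a.dim = k then g a b else w a b, fun x y z hxy hyz hx => ?_,
        fun e f hef => ?_⟩
      · have h1 := Cell.dim_lt_dim hxy
        have hy : ¬ y.dim = k := by omega
        by_cases hxk : x.dim = k
        · simp only [if_pos hxk, if_neg hy]
          rw [hg x hxk y z hxy hyz]
          abel
        · simp only [if_neg hxk, if_neg hy]
          exact hw x y z hxy hyz (by omega)
      · have he := e.2
        have he' : ¬ e.1.dim = k := by omega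
        simp only [if_neg he']
        exact hwc e f hef
  rcases Nat.eq_zero_or_pos d with hd | hd
  · refine ⟨fun _ _ => 0, fun _ _ _ _ _ => by simp, fun e => ?_⟩
    have := e.2
    omega
  · obtain ⟨w, hw, hwc⟩ := key (d - 1) 0 (by omega)
    exact ⟨w, fun a b c hab hbc => hw a b c hab hbc (Nat.zero_le _), hwc⟩

/-! ### Generators of the first homology -/

/-- The first homology group of the complex is generated by the classes of face-cycles. -/
theorem span_homologyClass_eq_top [Finite (Cell C)] (hdim : ∀ x : Cell C, x.dim ≤ d)
    (hlink : LinkCondition C d) :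
    Submodule.span ℤ (Set.range fun γ : FaceCycle C d => γ.homologyClass) = ⊤ := by
  classical
  -- The universal cocycle that vanishes on all face-cycles takes values in the quotient of the
  -- 1-chains by boundaries and face-cycles.
  set U : Submodule ℤ (Chain1 (Cell C)) := LinearMap.range (bd2 (Cell C)) ⊔
    Submodule.span ℤ (Set.range fun γ : FaceCycle C d => γ.chain) with hU
  let w : Cell C → Cell C → Chain1 (Cell C) ⧸ U := fun a b =>
    if h : a < b then U.mkQ (Finsupp.single ⟨(a, b), h⟩ 1) else 0
  have hwpos : ∀ a b (h : a < b), w a b = U.mkQ (Finsupp.single ⟨(a, b), h⟩ 1) :=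
    fun a b h => dif_pos h
  have hw : ∀ a b c, a < b → b < c → w a c = w a b + w b c := by
    intro a b c hab hbc
    rw [hwpos a b hab, hwpos b c hbc, hwpos a c (hab.trans hbc), ← map_add, ← sub_eq_zero,
      ← map_sub, Submodule.mkQ_apply, Submodule.Quotient.mk_eq_zero]
    refine Submodule.mem_sup_left ⟨-Finsupp.single ⟨(a, b, c), hab, hbc⟩ 1, ?_⟩
    rw [map_neg, bd2, Finsupp.linearCombination_single, one_smul]
    abel
  have heval : evalChain w = U.mkQ := by
    refine Finsupp.lhom_ext fun t n => ?_
    obtain ⟨⟨a, b⟩, hab⟩ := t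
    rw [evalChain_single, hwpos a b hab, ← map_smul, Finsupp.smul_single, smul_eq_mul, mul_one]
  obtain ⟨φ, hφ⟩ := exists_potential_of_loops (c := fun e f => w e.1 f.1) (fun γ _ => by
    rw [← FacePath.evalChain_chain, heval, Submodule.mkQ_apply, Submodule.Quotient.mk_eq_zero]
    exact Submodule.mem_sup_right (Submodule.subset_span ⟨γ, rfl⟩))
  obtain ⟨g, hg⟩ := exists_potential_of_top hw hdim hlink.1 hφ
  have hker : ∀ z, bd1 (Cell C) z = 0 → z ∈ U := by
    intro z hz
    have : evalChain w = (Finsupp.linearCombination ℤ g) ∘ₗ bd1 (Cell C) := by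
      refine Finsupp.lhom_ext fun t n => ?_
      obtain ⟨⟨a, b⟩, hab⟩ := t
      rw [evalChain_single, LinearMap.comp_apply, bd1_single, map_sub,
        Finsupp.linearCombination_single, Finsupp.linearCombination_single, hg a b hab, smul_sub]
    rw [← Submodule.Quotient.mk_eq_zero U, ← Submodule.mkQ_apply, ← heval, this,
      LinearMap.comp_apply, hz, map_zero]
  rw [eq_top_iff]
  rintro x -
  obtain ⟨⟨z, hz⟩, rfl⟩ := Submodule.Quotient.mk_surjective _ x
  obtain ⟨b, hb, s, hs, hbs⟩ := Submodule.mem_sup.1 (hker z hz)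
  have hs' : ∀ s ∈ Submodule.span ℤ (Set.range fun γ : FaceCycle C d => γ.chain),
      ∃ hs : bd1 (Cell C) s = 0, (Submodule.Quotient.mk ⟨s, hs⟩ : H1 (Cell C)) ∈
        Submodule.span ℤ (Set.range fun γ : FaceCycle C d => γ.homologyClass) := by
    intro s hs
    induction hs using Submodule.span_induction with
    | mem s h =>
      obtain ⟨γ, rfl⟩ := h
      refine ⟨by rw [FacePath.bd1_chain, γ.closed, sub_self], Submodule.subset_span ⟨γ, rfl⟩⟩
    | zero => exact ⟨map_zero _, Submodule.zero_mem _⟩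
    | add x y _ _ hx hy =>
      obtain ⟨hx, hx'⟩ := hx
      obtain ⟨hy, hy'⟩ := hy
      exact ⟨by rw [map_add, hx, hy, add_zero], Submodule.add_mem _ hx' hy'⟩
    | smul n x _ hx =>
      obtain ⟨hx, hx'⟩ := hx
      exact ⟨by rw [map_smul, hx, smul_zero], Submodule.smul_mem _ n hx'⟩
  obtain ⟨hs0, hs1⟩ := hs' s hs
  convert hs1 using 1
  rw [Submodule.Quotient.eq]
  change z - s ∈ LinearMap.range (bd2 (Cell C))
  rwa [← hbs, add_sub_cancel_right]

theorem exists_generateH1 [Finite (Cell C)] (hdim : ∀ x : Cell C, x.dim ≤ d)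
    (hlink : LinkCondition C d) :
    ∃ (k : ℕ) (γ : Fin k → FaceCycle C d), GenerateH1 γ := by
  classical
  have htop := span_homologyClass_eq_top hdim hlink
  -- The 1-chains are a Noetherian module since there are finitely many cells.
  have hfg : (Submodule.span ℤ
      (Set.range fun γ : FaceCycle C d => γ.homologyClass)).FG := by
    rw [htop]
    exact Module.Finite.fg_top
  obtain ⟨s, hs, hspan⟩ := (Submodule.fg_span_iff_fg_span_finset_subset _).1 hfg
  choose γ hγ using hs
  refine ⟨s.card, fun i => γ (s.equivFin.symm i).2, ?_⟩
  rw [GenerateH1, ← htop, hspan]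
  congr 1
  ext x
  constructor
  · rintro ⟨i, rfl⟩
    have := hγ (s.equivFin.symm i).2
    dsimp only at this ⊢
    rw [this]
    exact (s.equivFin.symm i).2
  · intro hx
    refine ⟨s.equivFin ⟨x, hx⟩, ?_⟩
    have := hγ (s.equivFin.symm (s.equivFin ⟨x, hx⟩)).2
    dsimp only at this ⊢
    rw [this, Equiv.symm_apply_apply]

end Gains

/-! ### Cocycles on simply connected complexes -/

section Covering

open Topology

variable {X : Type u} [TopologicalSpace X] {C : Set X} [CWComplex C]

/-- The cell whose open cell contains a given point. -/
def cellOf (q : C) : Cell C := (Cell.exists_mem_interior q.2).choose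

theorem mem_interior_cellOf (q : C) : (q : X) ∈ (cellOf q).interior :=
  (Cell.exists_mem_interior q.2).choose_spec

theorem cellOf_eq {q : C} {x : Cell C} (h : (q : X) ∈ x.interior) : cellOf q = x :=
  Cell.eq_of_mem_interior (mem_interior_cellOf q) h

/-- The open star of a cell. -/
def openStar (x : Cell C) : Set C := {q | x ≤ cellOf q}

theorem IsRegular.isOpen_openStar [T2Space X] [RelCWComplex.Finite C] (hreg : IsRegular C)
    (x : Cell C) : IsOpen (openStar x) := by
  have := finite_cell (C := C)
  have h : (openStar x)ᶜ = ⋃ y ∈ {y : Cell C | ¬ x ≤ y}, (Subtype.val : C → X) ⁻¹' y.carrier := by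
    ext q
    simp only [openStar, Set.mem_compl_iff, Set.mem_ofPred_eq, Set.mem_iUnion, Set.mem_preimage,
      exists_prop]
    constructor
    · exact fun h => ⟨cellOf q, h, (cellOf q).interior_subset (mem_interior_cellOf q)⟩
    · rintro ⟨y, hy, hq⟩ h
      exact hy (h.trans (hreg.le_of_mem_interior (mem_interior_cellOf q) hq))
  rw [← isClosed_compl_iff, h]
  exact (Set.toFinite _).isClosed_biUnion fun y _ =>
    RelCWComplex.isClosed_closedCell.preimage continuous_subtype_val

variable {A : Type*} [AddCommGroup A]

open Classical in
/-- A function on pairs `a < b`, extended by zero to the other pairs. -/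
def extendZero (w : Cell C → Cell C → A) (a b : Cell C) : A := if a < b then w a b else 0

theorem extendZero_self (w : Cell C → Cell C → A) (a : Cell C) : extendZero w a a = 0 :=
  if_neg (lt_irrefl a)

theorem extendZero_add {w : Cell C → Cell C → A}
    (hw : ∀ a b c, a < b → b < c → w a c = w a b + w b c) {a b c : Cell C} (hab : a ≤ b)
    (hbc : b ≤ c) : extendZero w a c = extendZero w a b + extendZero w b c := by
  rcases Cell.eq_or_lt_of_le hab with rfl | hab
  · rw [extendZero_self, zero_add]
  rcases Cell.eq_or_lt_of_le hbc with rfl | hbc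
  · rw [extendZero_self, add_zero]
  rw [extendZero, extendZero, extendZero, if_pos hab, if_pos hbc, if_pos (hab.trans hbc),
    hw a b c hab hbc]

/-- The covering space defined by a 1-cocycle `w` on the face poset. Over the open star of a cell
`x` its sheets are the graphs of the functions `q ↦ a + w(x, y)`, where `y` is the cell containing
`q` in its interior. -/
@[reducible]
def coveringCore [T2Space X] [RelCWComplex.Finite C] [TopologicalSpace A] [DiscreteTopology A]
    (hreg : IsRegular C) {w : Cell C → Cell C → A}
    (hw : ∀ a b c, a < b → b < c → w a c = w a b + w b c) : FiberBundleCore (Cell C) C A where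
  baseSet := openStar
  isOpen_baseSet := hreg.isOpen_openStar
  indexAt := cellOf
  mem_baseSet_at := fun q => le_refl (cellOf q)
  coordChange := fun x y q a => a + extendZero w x (cellOf q) - extendZero w y (cellOf q)
  coordChange_self := fun x q _ a => by rw [add_sub_cancel_right]
  continuousOn_coordChange := by
    rintro x y ⟨q, a⟩ ⟨⟨hx, hy⟩, -⟩
    refine ContinuousAt.continuousWithinAt ?_
    refine ContinuousAt.congr (f := fun p : C × A =>
      p.2 + (extendZero w x (cellOf q) - extendZero w y (cellOf q))) ?_ ?_
    · exact (continuous_of_discreteTopology (f := fun a : A =>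
        a + (extendZero w x (cellOf q) - extendZero w y (cellOf q)))).continuousAt.comp
          continuousAt_snd
    · have hmem : openStar (cellOf q) ∈ nhds q :=
        (hreg.isOpen_openStar _).mem_nhds (le_refl (cellOf q))
      have hmem' : ∀ᶠ p : C × A in nhds (q, a), p.1 ∈ openStar (cellOf q) :=
        continuousAt_fst.eventually_mem (x := (q, a)) hmem
      filter_upwards [hmem'] with p hp
      rw [extendZero_add hw (a := x) (b := cellOf q) hx hp,
        extendZero_add hw (a := y) (b := cellOf q) hy hp]
      abel
  coordChange_comp := fun x y z q _ a => by abel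

/-- A path inside a closed cell `y` from the center of a face `x` of `y` to the center of `y`,
which enters the open cell immediately. -/
theorem exists_path_center {x y : Cell C} (h : x < y) (hx : x.center ∈ C) (hy : y.center ∈ C) :
    ∃ γ : Path (⟨x.center, hx⟩ : C) ⟨y.center, hy⟩, ∀ t, x ≤ cellOf (γ t) := by
  obtain ⟨b, hb, hbx⟩ := h.le (x.interior_subset x.center_mem_interior)
  have hball : ∀ t : unitInterval, (1 - (t : ℝ)) • b ∈ Metric.closedBall (0 : Fin y.dim → ℝ) 1 := by
    intro t
    rw [mem_closedBall_zero_iff] at hb ⊢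
    rw [norm_smul, Real.norm_of_nonneg (by linarith [t.2.2])]
    have := t.2.1
    nlinarith [norm_nonneg b]
  have hopen : ∀ t : unitInterval, t ≠ 0 → y.charMap ((1 - (t : ℝ)) • b) ∈ y.interior := by
    intro t ht
    refine Set.mem_image_of_mem _ ?_
    have h0 : 0 < (t : ℝ) := lt_of_le_of_ne t.2.1 (fun h => ht (Subtype.ext h.symm))
    rw [mem_closedBall_zero_iff] at hb
    rw [mem_ball_zero_iff, norm_smul, Real.norm_of_nonneg (by linarith [t.2.2])]
    nlinarith [norm_nonneg b, t.2.2]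
  have hC : ∀ t : unitInterval, y.charMap ((1 - (t : ℝ)) • b) ∈ C := fun t =>
    y.carrier_subset (Set.mem_image_of_mem _ (hball t))
  have h0 : y.charMap ((1 - ((0 : unitInterval) : ℝ)) • b) = x.center := by
    rw [Set.Icc.coe_zero, sub_zero, one_smul]
    exact hbx
  refine ⟨⟨⟨fun t => ⟨y.charMap ((1 - (t : ℝ)) • b), hC t⟩, ?_⟩, ?_, ?_⟩, fun t => ?_⟩
  · refine Continuous.subtype_mk ?_ _
    exact (RelCWComplex.continuousOn y.dim y.idx).comp_continuous (by fun_prop) hball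
  · exact Subtype.ext h0
  · exact Subtype.ext (by simp [Cell.center])
  · change x ≤ cellOf ⟨y.charMap ((1 - (t : ℝ)) • b), hC t⟩
    by_cases ht : t = 0
    · subst ht
      have hmem : y.charMap ((1 - ((0 : unitInterval) : ℝ)) • b) ∈ x.interior :=
        h0 ▸ x.center_mem_interior
      rw [cellOf_eq (q := ⟨_, hC 0⟩) hmem]
    · rw [cellOf_eq (x := y) (hopen t ht)]
      exact h.le

/-- On a simply connected regular complex every 1-cocycle on the face poset is a coboundary: the
covering space that it defines has no monodromy. -/
theorem IsRegular.exists_potential_of_simplyConnected [T2Space X] [RelCWComplex.Finite C]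
    (hreg : IsRegular C) [SimplyConnectedSpace C] {w : Cell C → Cell C → A}
    (hw : ∀ a b c, a < b → b < c → w a c = w a b + w b c) :
    ∃ g : Cell C → A, ∀ a b, a < b → w a b = g b - g a := by
  let _ : TopologicalSpace A := ⊥
  have : DiscreteTopology A := ⟨rfl⟩
  let Z := coveringCore hreg hw
  have cov : IsCoveringMap Z.proj := FiberBundle.isCoveringMap
  have hC : ∀ x : Cell C, x.center ∈ C := fun x =>
    x.carrier_subset (x.interior_subset x.center_mem_interior)
  let ctr : Cell C → C := fun x => ⟨x.center, hC x⟩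
  have hctr : ∀ x, cellOf (ctr x) = x := fun x => cellOf_eq x.center_mem_interior
  obtain ⟨q₀⟩ : Nonempty C := inferInstance
  let e₀ : Z.proj ⁻¹' {q₀} := ⟨⟨q₀, (0 : A)⟩, rfl⟩
  let cls : ∀ a b : C, Path.Homotopic.Quotient a b := fun a b => ⟦PathConnectedSpace.somePath a b⟧
  let E : ∀ x, Z.proj ⁻¹' {ctr x} := fun x => cov.monodromy (cls q₀ (ctr x)) e₀
  have hE : ∀ x, ∃ a : A, E x = ⟨⟨ctr x, a⟩, rfl⟩ := by
    intro x
    obtain ⟨⟨q, a⟩, hq⟩ := E x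
    have hq' : q = ctr x := hq
    subst hq'
    exact ⟨a, rfl⟩
  -- The potential of `x` is the height in the fiber reached by lifting a path from `q₀` to `x`.
  choose g hg using hE
  refine ⟨g, fun x y hxy => ?_⟩
  obtain ⟨γ, hγ⟩ := exists_path_center hxy (hC x) (hC y)
  let Γ : Path (⟨ctr x, g x⟩ : Z.TotalSpace) ⟨ctr y, g x + w x y⟩ :=
    { toFun := fun t => (Z.localTriv x).toOpenPartialHomeomorph.symm (γ t, g x)
      continuous_toFun := by
        refine (Z.localTriv x).toOpenPartialHomeomorph.continuousOn_symm.comp_continuous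
          (by fun_prop) fun t => ?_
        rw [Bundle.Trivialization.mem_target]
        exact hγ t
      source' := by
        rw [FiberBundleCore.localTriv_symm_apply, γ.source]
        refine congrArg (fun a : A => (⟨ctr x, a⟩ : Z.TotalSpace)) ?_
        change g x + extendZero w x (cellOf (ctr x)) - extendZero w (cellOf (ctr x))
          (cellOf (ctr x)) = g x
        rw [hctr, extendZero_self]
        abel
      target' := by
        rw [FiberBundleCore.localTriv_symm_apply, γ.target]
        refine congrArg (fun a : A => (⟨ctr y, a⟩ : Z.TotalSpace)) ?_
        change g x + extendZero w x (cellOf (ctr y)) - extendZero w (cellOf (ctr y))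
          (cellOf (ctr y)) = g x + w x y
        rw [hctr, extendZero_self, extendZero, if_pos hxy]
        abel }
  -- `Γ` lifts a path from `x` to `y`, and any two paths with the same ends are homotopic.
  have h1 : cov.monodromy (cls (ctr x) (ctr y)) (E x) = ⟨⟨ctr y, g x + w x y⟩, rfl⟩ := by
    rw [hg x]
    refine cov.monodromy_eq_of_map_eq (Γ := ⟦Γ⟧) ?_
    exact Subsingleton.elim _ _
  have h2 : E y = cov.monodromy (cls (ctr x) (ctr y)) (E x) := by
    change _ = cov.monodromy _ (cov.monodromy _ _)
    rw [← cov.monodromy_trans_apply]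
    exact congrArg (fun γ => cov.monodromy γ e₀) (Subsingleton.elim _ _)
  rw [h1, hg y] at h2
  have h3 : g y = g x + w x y := by
    have := congrArg Subtype.val h2
    exact eq_of_heq (Bundle.TotalSpace.mk.inj this).2
  rw [h3, add_sub_cancel_left]

end Covering

/-! ### Equilibrium at an edge -/

section LinearAlgebra

variable {E : Type*} [NormedAddCommGroup E] [InnerProductSpace ℝ E] [FiniteDimensional ℝ E]

theorem exists_smul_eq_of_mem_orthogonal {K L : Submodule ℝ E} (hKL : K ≤ L)
    (hrank : Module.finrank ℝ L = Module.finrank ℝ K + 1) {n : E} (hn : n ∈ L) (hnK : n ∈ Kᗮ)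
    (hn0 : n ≠ 0) {v : E} (hv : v ∈ L) (hvK : v ∈ Kᗮ) : ∃ c : ℝ, v = c • n := by
  have h1 := Submodule.finrank_add_inf_finrank_orthogonal hKL
  have h2 : Module.finrank ℝ (Kᗮ ⊓ L : Submodule ℝ E) = 1 := by omega
  obtain ⟨c, hc⟩ := (finrank_eq_one_iff_of_nonzero' (⟨n, hnK, hn⟩ : (Kᗮ ⊓ L : Submodule ℝ E))
    (fun h => hn0 (congrArg Subtype.val h))).1 h2 ⟨v, hvK, hv⟩
  exact ⟨c, (congrArg Subtype.val hc).symm⟩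

/-- A subspace is contained in any subspace that contains a hyperplane of it and a normal of this
hyperplane. -/
theorem le_of_mem_of_mem_orthogonal {K L M : Submodule ℝ E} (hKL : K ≤ L)
    (hrank : Module.finrank ℝ L = Module.finrank ℝ K + 1) {n : E} (hn : n ∈ L) (hnK : n ∈ Kᗮ)
    (hn0 : n ≠ 0) (hKM : K ≤ M) (hnM : n ∈ M) : L ≤ M := by
  intro v hv
  have h1 : v - K.starProjection v ∈ Kᗮ := Submodule.sub_starProjection_mem_orthogonal v
  have h2 : K.starProjection v ∈ K := Submodule.starProjection_apply_mem K v
  obtain ⟨c, hc⟩ := exists_smul_eq_of_mem_orthogonal hKL hrank hn hnK hn0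
    (L.sub_mem hv (hKL h2)) h1
  rw [← sub_add_cancel v (K.starProjection v), hc]
  exact M.add_mem (M.smul_mem c hnM) (hKM h2)

/-- The linear relations between three pairwise independent vectors of a plane are the multiples of
one relation, all of whose coefficients are non-zero. -/
theorem exists_relation_coefficients {V : Type*} [AddCommGroup V] [Module ℝ V]
    [FiniteDimensional ℝ V] (hV : Module.finrank ℝ V ≤ 2) {ι : Type*} [Fintype ι]
    (hι : Fintype.card ι = 3) {n : ι → V} (hn : ∀ i j, i ≠ j → ∀ c : ℝ, n i ≠ c • n j) :
    ∃ a : ι → ℝˣ, ∀ s : ι → ℝ, ∑ i, s i • n i = 0 ↔ ∃ t : ℝ, ∀ i, s i = t * a i := by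
  have two : ∀ i j, i ≠ j → ∀ x y : ℝ, x • n i + y • n j = 0 → x = 0 := by
    intro i j hij x y h
    by_contra hx
    refine hn i j hij (-(x⁻¹ * y)) ?_
    rw [neg_smul, mul_smul, eq_neg_iff_add_eq_zero]
    have := congrArg (fun v => x⁻¹ • v) h
    simpa [smul_add, smul_smul, inv_mul_cancel₀ hx] using this
  -- A relation with one vanishing coefficient is trivial.
  have key : ∀ g : ι → ℝ, ∑ i, g i • n i = 0 → ∀ i, g i = 0 → g = 0 := by
    let σ := Fintype.equivFinOfCardEq hι
    intro g hg i hi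
    have hinj : ∀ {x y : Fin 3}, x ≠ y → σ.symm x ≠ σ.symm y := fun h h' =>
      h (σ.symm.injective h')
    have hsum : g (σ.symm 0) • n (σ.symm 0) + g (σ.symm 1) • n (σ.symm 1) +
        g (σ.symm 2) • n (σ.symm 2) = 0 := by
      rw [← Fin.sum_univ_three (fun x => g (σ.symm x) • n (σ.symm x)), ← hg]
      exact σ.symm.sum_comp (fun x => g x • n x)
    have hall : ∀ x : Fin 3, g (σ.symm x) = 0 := by
      obtain ⟨x, rfl⟩ := σ.symm.surjective i
      have h01 : (0 : Fin 3) ≠ 1 := by decide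
      have h02 : (0 : Fin 3) ≠ 2 := by decide
      have h12 : (1 : Fin 3) ≠ 2 := by decide
      fin_cases x
      · have hi' : g (σ.symm 0) = 0 := hi
        rw [hi', zero_smul, zero_add] at hsum
        have h1 := two _ _ (hinj h12) _ _ hsum
        have h2 := two _ _ (hinj h12.symm) _ _ (by rw [add_comm]; exact hsum)
        intro x
        fin_cases x
        exacts [hi', h1, h2]
      · have hi' : g (σ.symm 1) = 0 := hi
        rw [hi', zero_smul, add_zero] at hsum
        have h1 := two _ _ (hinj h02) _ _ hsum
        have h2 := two _ _ (hinj h02.symm) _ _ (by rw [add_comm]; exact hsum)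
        intro x
        fin_cases x
        exacts [h1, hi', h2]
      · have hi' : g (σ.symm 2) = 0 := hi
        rw [hi', zero_smul, add_zero] at hsum
        have h1 := two _ _ (hinj h01) _ _ hsum
        have h2 := two _ _ (hinj h01.symm) _ _ (by rw [add_comm]; exact hsum)
        intro x
        fin_cases x
        exacts [h1, h2, hi']
    funext j
    have := hall (σ j)
    rwa [Equiv.symm_apply_apply] at this
  -- Three vectors in a plane are dependent.
  obtain ⟨g, hg, i₀, hi₀⟩ : ∃ g : ι → ℝ, ∑ i, g i • n i = 0 ∧ ∃ i, g i ≠ 0 := by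
    refine Fintype.not_linearIndependent_iff.1 fun h => ?_
    have := h.fintype_card_le_finrank
    omega
  have hne : ∀ i, g i ≠ 0 := fun i h => hi₀ (congrFun (key g hg i h) i₀)
  refine ⟨fun i => Units.mk0 (g i) (hne i), fun s => ⟨fun hs => ⟨s i₀ / g i₀, ?_⟩, ?_⟩⟩
  · have h := key (fun i => s i - s i₀ / g i₀ * g i) (by
      simp only [sub_smul, mul_smul, Finset.sum_sub_distrib, ← Finset.smul_sum, hs, hg, smul_zero,
        sub_zero]) i₀ (by rw [div_mul_cancel₀ _ hi₀, sub_self])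
    intro i
    exact sub_eq_zero.1 (congrFun h i)
  · rintro ⟨t, ht⟩
    simp only [ht, mul_smul, ← Finset.smul_sum, Units.val_mk0, hg, smul_zero]

end LinearAlgebra

section Equilibrium

variable {X : Type u} [TopologicalSpace X] {C : Set X} [Topology.CWComplex C] {d : ℕ}

theorem RFramework.dir_mono (R : RFramework C d) {x y : Cell C} (h : x ≤ y) :
    R.dir x ≤ R.dir y :=
  vectorSpan_mono ℝ (Set.image_mono fun _ hw => le_trans hw h)

theorem RFramework.finrank_dir (R : RFramework C d) (x : Cell C) :
    Module.finrank ℝ (R.dir x) = x.dim := R.realizes x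

/-- Every cell has a vertex: otherwise it would not span a plane of its dimension. -/
theorem RFramework.exists_vertex (R : RFramework C d) (x : Cell C) :
    ∃ w, (⟨0, w⟩ : Cell C) ≤ x := by
  by_cases hx : x.dim = 0
  · obtain ⟨n, i⟩ := x
    subst hx
    exact ⟨i, le_rfl⟩
  · by_contra h
    refine hx ?_
    rw [← R.realizes x, show {w | (⟨0, w⟩ : Cell C) ≤ x} = ∅ by
      ext w
      exact ⟨fun hw => h ⟨w, hw⟩, fun hw => absurd hw (Set.notMem_empty w)⟩]
    simp

theorem RFramework.plane_eq_of_dir_eq (R : RFramework C d) {x y z : Cell C} (hx : z ≤ x)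
    (hy : z ≤ y) (h : R.dir x = R.dir y) : R.plane x = R.plane y := by
  obtain ⟨w, hw⟩ := R.exists_vertex z
  refine AffineSubspace.ext_of_direction_eq ?_ ⟨R.p w, ?_, ?_⟩
  · rw [RFramework.plane, RFramework.plane, direction_affineSpan, direction_affineSpan]
    exact h
  · exact subset_affineSpan ℝ _ ⟨w, hw.trans hx, rfl⟩
  · exact subset_affineSpan ℝ _ ⟨w, hw.trans hy, rfl⟩

theorem RFramework.finrank_dir_face (R : RFramework C d) (e : Edge C d) (f : Face C d) :
    Module.finrank ℝ (R.dir f.1) = Module.finrank ℝ (R.dir e.1) + 1 := by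
  rw [R.finrank_dir, R.finrank_dir, f.2, e.2]

namespace Normals

variable {R : RFramework C d} (N : Normals R)

theorem n_ne_zero {e : Edge C d} {f : Face C d} (h : e.1 < f.1) : N.n e f ≠ 0 := by
  rw [← norm_ne_zero_iff, N.norm_eq e f h]
  exact one_ne_zero

/-- Genericity: the normals of two faces at a common edge are not parallel. -/
theorem n_ne_smul (hgen : R.Generic) {e : Edge C d} {f g : Face C d} (hf : e.1 < f.1)
    (hg : e.1 < g.1) (hfg : f ≠ g) (c : ℝ) : N.n e f ≠ c • N.n e g := by
  intro h
  refine hgen e f g hf hg hfg (R.plane_eq_of_dir_eq hf.le hg.le ?_)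
  refine Submodule.eq_of_le_of_finrank_eq ?_ (by rw [R.finrank_dir, R.finrank_dir, f.2, g.2])
  refine le_of_mem_of_mem_orthogonal (R.dir_mono hf.le) (R.finrank_dir_face e f)
    (N.mem e f hf) (N.perp e f hf) (N.n_ne_zero hf) (R.dir_mono hg.le) ?_
  rw [h]
  exact (R.dir g.1).smul_mem c (N.mem e g hg)

/-- The values `c e f` are the coefficients, unique up to a common factor, of the linear relation
between the normals at `e`. They are written additively, so that stress transition across `e` from
`f` to `g` is addition of `c e g - c e f`. -/
def IsCoefficients (c : Edge C d → Face C d → Additive ℝˣ) : Prop :=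
  ∀ (e : Edge C d) (s : Face C d → ℝ),
    N.EquilibriumAt s e ↔ ∃ t : ℝ, ∀ f, e.1 < f.1 → s f = t * ((c e f).toMul : ℝˣ)

theorem exists_isCoefficients (hgen : R.Generic) (htri : Trivalent C d) :
    ∃ c, N.IsCoefficients c := by
  classical
  have h : ∀ e : Edge C d, ∃ a : {f : Face C d // e.1 < f.1} → ℝˣ, ∀ s : Face C d → ℝ,
      N.EquilibriumAt s e ↔ ∃ t : ℝ, ∀ f, s f.1 = t * a f := by
    intro e
    have hfin : Finite {f : Face C d // e.1 < f.1} := Nat.finite_of_card_ne_zero (by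
      rw [htri e]
      decide)
    let _ := Fintype.ofFinite {f : Face C d // e.1 < f.1}
    have hcard : Fintype.card {f : Face C d // e.1 < f.1} = 3 := by
      rw [← Nat.card_eq_fintype_card, htri e]
    have hrank : Module.finrank ℝ (R.dir e.1)ᗮ ≤ 2 := by
      have h1 := (R.dir e.1).finrank_add_finrank_orthogonal
      rw [R.finrank_dir, finrank_euclideanSpace_fin] at h1
      have := e.2
      omega
    obtain ⟨a, ha⟩ := exists_relation_coefficients hrank hcard
      (n := fun f => (⟨N.n e f.1, N.perp e f.1 f.2⟩ : (R.dir e.1)ᗮ)) (fun f g hfg c h =>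
        N.n_ne_smul hgen f.2 g.2 (fun h => hfg (Subtype.ext h)) c (congrArg Subtype.val h))
    refine ⟨a, fun s => ?_⟩
    rw [← ha fun f => s f.1, EquilibriumAt, finsum_eq_sum_of_fintype, ← Submodule.coe_eq_zero,
      AddSubmonoidClass.coe_finsetSum]
    rfl
  choose a ha using h
  refine ⟨fun e f => if h : e.1 < f.1 then Additive.ofMul (a e ⟨f, h⟩) else 0, fun e s => ?_⟩
  rw [ha]
  refine exists_congr fun t => ⟨fun h f hf => ?_, fun h f => ?_⟩
  · simp only [dif_pos hf]
    exact h ⟨f, hf⟩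
  · have := h f.1 f.2
    simp only [dif_pos f.2] at this
    exact this

variable {N} {c : Edge C d → Face C d → Additive ℝˣ}

theorem IsCoefficients.ne_zero_of_ne_zero (hc : N.IsCoefficients c) {s : Face C d → ℝ}
    {e : Edge C d} (hs : N.EquilibriumAt s e) {f g : Face C d} (hf : e.1 < f.1) (hg : e.1 < g.1)
    (h : s f ≠ 0) : s g ≠ 0 := by
  obtain ⟨t, ht⟩ := (hc e s).1 hs
  rw [ht f hf] at h
  rw [ht g hg]
  exact mul_ne_zero (left_ne_zero_of_mul h) (Units.ne_zero _)

/-- The logarithm of a nowhere vanishing stress is a potential. -/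
theorem IsCoefficients.exists_potential (hc : N.IsCoefficients c) {s : Face C d → ℝ}
    {S : Set (Edge C d)} (hs : ∀ e ∈ S, N.EquilibriumAt s e)
    (hne : ∀ e ∈ S, ∀ f : Face C d, e.1 < f.1 → s f ≠ 0) :
    ∃ φ : Face C d ⊕ Edge C d → Additive ℝˣ,
      ∀ e ∈ S, ∀ f : Face C d, e.1 < f.1 → c e f = φ (Sum.inl f) - φ (Sum.inr e) := by
  classical
  have h : ∀ e, ∃ t : ℝ, e ∈ S → ∀ f, e.1 < f.1 → s f = t * ((c e f).toMul : ℝˣ) := by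
    intro e
    by_cases he : e ∈ S
    · obtain ⟨t, ht⟩ := (hc e s).1 (hs e he)
      exact ⟨t, fun _ => ht⟩
    · exact ⟨0, fun h => absurd h he⟩
  choose t ht using h
  -- The value of `L` at zero is never used.
  let L : ℝ → Additive ℝˣ := fun x => if h : x = 0 then 0 else Additive.ofMul (Units.mk0 x h)
  refine ⟨Sum.elim (fun f => L (s f)) (fun e => L (t e)), fun e he f hf => ?_⟩
  have h1 := ht e he f hf
  have h2 := hne e he f hf
  have h3 : t e ≠ 0 := left_ne_zero_of_mul (h1 ▸ h2)
  rw [Sum.elim_inl, Sum.elim_inr, eq_sub_iff_add_eq, add_comm]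
  change L (t e) + c e f = L (s f)
  rw [show L (t e) = _ from dif_neg h3, show L (s f) = _ from dif_neg h2]
  apply Additive.toMul.injective
  apply Units.ext
  exact h1.symm

theorem IsCoefficients.equilibriumAt_of_potential (hc : N.IsCoefficients c)
    {φ : Face C d ⊕ Edge C d → Additive ℝˣ} {e : Edge C d}
    (hφ : ∀ f : Face C d, e.1 < f.1 → c e f = φ (Sum.inl f) - φ (Sum.inr e)) :
    N.EquilibriumAt (fun f => (((φ (Sum.inl f)).toMul : ℝˣ) : ℝ)) e := by
  refine (hc e _).2 ⟨((φ (Sum.inr e)).toMul : ℝˣ), fun f hf => ?_⟩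
  rw [← Units.val_mul, ← toMul_add, hφ f hf, add_sub_cancel]

theorem IsCoefficients.selfStressable_of_potential (hc : N.IsCoefficients c)
    (hne : Nonempty (Face C d)) {φ : Face C d ⊕ Edge C d → Additive ℝˣ}
    (hφ : ∀ (e : Edge C d) (f : Face C d), e.1 < f.1 →
      c e f = φ (Sum.inl f) - φ (Sum.inr e)) : N.SelfStressable := by
  obtain ⟨f⟩ := hne
  refine ⟨fun f => (((φ (Sum.inl f)).toMul : ℝˣ) : ℝ), fun h => ?_, fun e =>
    hc.equilibriumAt_of_potential (hφ e)⟩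
  exact Units.ne_zero _ (congrFun h f)

theorem IsCoefficients.selfStressable_of_loops [Finite (Cell C)] (hc : N.IsCoefficients c)
    (hne : Nonempty (Face C d)) (h : ∀ γ : FaceCycle C d, γ.IsLoop → γ.gain c = 0) :
    N.SelfStressable := by
  obtain ⟨φ, hφ⟩ := exists_potential_of_loops h
  exact hc.selfStressable_of_potential hne hφ

/-- A self-stress of a face-connected framework does not vanish on any face. -/
theorem IsCoefficients.exists_nonvanishing (hc : N.IsCoefficients c) (hconn : FaceConnected C d)
    (h : N.SelfStressable) :
    ∃ s : Face C d → ℝ, (∀ f, s f ≠ 0) ∧ ∀ e, N.EquilibriumAt s e := by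
  obtain ⟨s, hs0, hs⟩ := h
  obtain ⟨f₀, hf₀⟩ := Function.ne_iff.1 hs0
  refine ⟨s, fun f => ?_, hs⟩
  induction hconn.2 f₀ f with
  | refl => exact hf₀
  | tail _ h ih =>
    obtain ⟨e, h1, h2⟩ := h
    exact hc.ne_zero_of_ne_zero (hs e) h1 h2 ih

theorem trivialMonodromy_of_nonvanishing {s : Face C d → ℝ} (hne : ∀ f, s f ≠ 0)
    (hs : ∀ e, N.EquilibriumAt s e) (γ : FaceCycle C d) : N.TrivialMonodromy γ := by
  refine ⟨fun i => s (γ.face i), fun i => ⟨s, rfl, rfl, hs _⟩, hne _, hne _, ?_⟩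
  dsimp only
  rw [← γ.closed, div_self (hne _)]

/-- The gain of a face-cycle is the logarithm of the inverse of its stress monodromy. -/
theorem IsCoefficients.gain_eq_zero (hc : N.IsCoefficients c) {γ : FaceCycle C d}
    (h : N.TrivialMonodromy γ) : γ.gain c = 0 := by
  obtain ⟨σ, hσ, h0, hlast, hm⟩ := h
  have hstep : ∀ i : Fin γ.length, ∃ t : ℝ,
      σ i.castSucc = t * ((c (γ.edge i) (γ.face i.castSucc)).toMul : ℝˣ) ∧
      σ i.succ = t * ((c (γ.edge i) (γ.face i.succ)).toMul : ℝˣ) := by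
    intro i
    obtain ⟨τ, h1, h2, h3⟩ := hσ i
    obtain ⟨t, ht⟩ := (hc _ _).1 h3
    exact ⟨t, by rw [← h1, ht _ (γ.left i)], by rw [← h2, ht _ (γ.right i)]⟩
  have hne : ∀ i, σ i ≠ 0 := by
    intro i
    induction i using Fin.induction with
    | zero => exact h0
    | succ i ih =>
      obtain ⟨t, h1, h2⟩ := hstep i
      rw [h1] at ih
      rw [h2]
      exact mul_ne_zero (left_ne_zero_of_mul ih) (Units.ne_zero _)
  let L : Fin (γ.length + 1) → Additive ℝˣ := fun i => Additive.ofMul (Units.mk0 (σ i) (hne i))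
  have hgain : γ.gain c = ∑ i : Fin γ.length, (L i.succ - L i.castSucc) := by
    refine Finset.sum_congr rfl fun i _ => ?_
    obtain ⟨t, h1, h2⟩ := hstep i
    rw [sub_eq_sub_iff_add_eq_add]
    apply Additive.toMul.injective
    apply Units.ext
    change (((c (γ.edge i) (γ.face i.succ)).toMul : ℝˣ) : ℝ) * σ i.castSucc =
      σ i.succ * ((c (γ.edge i) (γ.face i.castSucc)).toMul : ℝˣ)
    rw [h1, h2]
    ring
  have hends : L (Fin.last γ.length) = L 0 := by
    apply Additive.toMul.injective
    apply Units.ext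
    change σ (Fin.last γ.length) = σ 0
    rw [eq_div_iff hlast, one_mul] at hm
    exact hm
  rw [hgain, sum_fin_sub, hends, sub_self]

end Normals

end Equilibrium

/-! ### Determinants of frames -/

section Frames

variable {E : Type*} [NormedAddCommGroup E] [InnerProductSpace ℝ E]

/-- The determinant of the matrix of inner products with the vectors of a frame `β`, as an
alternating function. -/
def frameDet {n : ℕ} (β : Fin n → E) : E [⋀^Fin n]→ₗ[ℝ] ℝ :=
  (Matrix.detRowAlternating (R := ℝ) (n := Fin n)).compLinearMap
    (LinearMap.pi fun i => (innerSL ℝ (β i) : E →ₗ[ℝ] ℝ))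

theorem frameDet_apply {n : ℕ} (β u : Fin n → E) :
    frameDet β u = (Matrix.of fun i j => ⟪β i, u j⟫).det := by
  rw [← Matrix.det_transpose]
  rfl

theorem frameDet_ne_zero {n : ℕ} {L : Submodule ℝ E} (b : OrthonormalBasis (Fin n) ℝ L)
    {u : Fin n → E} (hu : Orthonormal ℝ u) (hL : ∀ i, u i ∈ L) :
    frameDet (fun i => (b i : E)) u ≠ 0 := by
  set M : Matrix (Fin n) (Fin n) ℝ := Matrix.of fun i j => ⟪(b i : E), u j⟫ with hM
  have h : M.transpose * M = 1 := by
    ext j k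
    rw [Matrix.mul_apply]
    have := b.sum_inner_mul_inner (⟨u j, hL j⟩ : L) ⟨u k, hL k⟩
    simp only [Submodule.coe_inner] at this
    simp only [hM, Matrix.transpose_apply, Matrix.of_apply]
    rw [Matrix.one_apply, ← orthonormal_iff_ite.1 hu j k, ← this]
    exact Finset.sum_congr rfl fun i _ => by rw [real_inner_comm]
  rw [frameDet_apply]
  intro h0
  have := congrArg Matrix.det h
  rw [Matrix.det_mul, h0, mul_zero, Matrix.det_one] at this
  exact zero_ne_one this

/-- Change of basis in all vectors but the first. -/
theorem frameDet_cons {n : ℕ} (β : Fin (n + 1) → E) (x : E) {L : Submodule ℝ E}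
    (b : OrthonormalBasis (Fin n) ℝ L) {w : Fin n → E} (hw : ∀ i, w i ∈ L) :
    frameDet β (Fin.cons x w) =
      frameDet (fun i => (b i : E)) w * frameDet β (Fin.cons x fun i => (b i : E)) := by
  have hexp : ∀ (y : E) j, ⟪y, w j⟫ = ∑ i, ⟪y, (b i : E)⟫ * ⟪(b i : E), w j⟫ := by
    intro y j
    have h := congrArg Subtype.val (b.sum_repr' ⟨w j, hw j⟩)
    simp only [Submodule.coe_inner, AddSubmonoidClass.coe_finsetSum, Submodule.coe_smul] at h
    conv_lhs => rw [← h]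
    rw [inner_sum]
    exact Finset.sum_congr rfl fun i _ => by rw [real_inner_smul_right, mul_comm]
  rw [frameDet_apply, frameDet_apply, frameDet_apply, Matrix.det_succ_column_zero,
    Matrix.det_succ_column_zero, Finset.mul_sum]
  refine Finset.sum_congr rfl fun i _ => ?_
  have hminor : (Matrix.of fun i j => ⟪β i, (Fin.cons x w : Fin (n + 1) → E) j⟫).submatrix
      i.succAbove Fin.succ =
      (Matrix.of fun i j => ⟪β i, (Fin.cons x (fun i => (b i : E)) : Fin (n + 1) → E) j⟫).submatrix
        i.succAbove Fin.succ * Matrix.of fun i j => ⟪(b i : E), w j⟫ := by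
    ext j k
    rw [Matrix.mul_apply]
    simp only [Matrix.submatrix_apply, Matrix.of_apply, Fin.cons_succ]
    exact hexp _ _
  rw [hminor, Matrix.det_mul]
  simp only [Matrix.of_apply, Fin.cons_zero]
  ring

/-- Running along a great circle from one end of an arc to the other, the frame formed by the
inward tangent and the position at the end reverses its orientation. -/
theorem alternating_rotate {n : ℕ} (F : E [⋀^Fin (n + 2)]→ₗ[ℝ] ℝ) (t p : E) (w : Fin n → E)
    (θ : ℝ) :
    F (Fin.cons (Real.sin θ • p - Real.cos θ • t)
      (Fin.cons (Real.cos θ • p + Real.sin θ • t) w : Fin (n + 1) → E)) =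
      - F (Fin.cons t (Fin.cons p w : Fin (n + 1) → E)) := by
  let G : E → E → ℝ := fun x y => F (Fin.cons x (Fin.cons y w : Fin (n + 1) → E))
  have hG : ∀ x y, G x y = (F.curryLeft x).curryLeft y w := fun x y => rfl
  have hself : ∀ x, G x x = 0 := fun x =>
    F.map_eq_zero_of_eq _ (i := 0) (j := 1) rfl Fin.zero_ne_one
  have hadd : ∀ x x' y, G (x + x') y = G x y + G x' y := fun x x' y => by
    rw [hG, hG, hG, map_add]; rfl
  have hadd' : ∀ x y y', G x (y + y') = G x y + G x y' := fun x y y' => by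
    rw [hG, hG, hG, map_add]; rfl
  have hsmul : ∀ (c : ℝ) x y, G (c • x) y = c * G x y := fun c x y => by
    rw [hG, hG, map_smul]; rfl
  have hsmul' : ∀ (c : ℝ) x y, G x (c • y) = c * G x y := fun c x y => by
    rw [hG, hG, map_smul]; rfl
  have hswap : G p t = - G t p := by
    have := hself (p + t)
    rw [hadd, hadd', hadd', hself, hself] at this
    linarith
  change G _ _ = - G t p
  rw [sub_eq_add_neg, ← neg_smul, hadd, hadd', hadd', hsmul, hsmul, hsmul, hsmul, hsmul', hsmul',
    hsmul', hsmul', hself, hself, hswap]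
  linear_combination (-G t p) * Real.sin_sq_add_cos_sq θ

end Frames

/-! ### The spherical framework of a `(d-2)`-cell -/

section Local

variable {X : Type u} [TopologicalSpace X] {C : Set X} [Topology.CWComplex C] {d : ℕ}
  {R : RFramework C d}

/-- The orthonormal basis of the plane of a cell, with its index set rewritten. -/
def Normals.basisCast (N : Normals R) (x : Cell C) {n : ℕ} (h : x.dim = n) :
    OrthonormalBasis (Fin n) ℝ (R.dir x) :=
  (N.basis x).reindex (finCongr h)

theorem Normals.basisCast_apply (N : Normals R) (x : Cell C) {n : ℕ} (h : x.dim = n) (i : Fin n) :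
    N.basisCast x h i = N.basis x (Fin.cast h.symm i) := by
  rw [Normals.basisCast, OrthonormalBasis.reindex_apply]
  rfl

theorem Normals.frameDet_normal (N : Normals R) {e : Edge C d} {f : Face C d} (hef : e.1 < f.1)
    {n : ℕ} (he : e.1.dim = n) (hf : f.1.dim = n + 1) :
    frameDet (fun i => (N.basisCast f.1 hf i : EuclideanSpace ℝ (Fin (d + 1))))
      (Fin.cons (N.n e f) fun i => (N.basisCast e.1 he i : EuclideanSpace ℝ (Fin (d + 1)))) =
      (N.orientation.inc f.1 e.1 : ℝ) := by
  rw [← N.oriented e f hef, frameDet_apply, ← Matrix.det_submatrix_equiv_self (finCongr hf.symm)]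
  congr 1
  ext i j
  simp only [Matrix.of_apply, Matrix.submatrix_apply, RFramework.frameMatrix,
    Normals.basisCast_apply]
  congr 1
  refine Fin.cases ?_ (fun k => ?_) j
  · rfl
  · rfl

variable {v : DVertex C d} (S : LocalFramework R v)

theorem LocalFramework.tail_lt (f : {f : Face C d // v.1 < f.1}) : (S.tail f).1.1 < f.1.1 :=
  (S.ends f _).2 (Or.inl rfl)

theorem LocalFramework.head_lt (f : {f : Face C d // v.1 < f.1}) : (S.head f).1.1 < f.1.1 :=
  (S.ends f _).2 (Or.inr rfl)

theorem LocalFramework.headDir_mem (f : {f : Face C d // v.1 < f.1}) :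
    (S.headDir f : EuclideanSpace ℝ (Fin (d + 1))) ∈ R.dir f.1.1 := by
  rw [SphericalFramework.headDir, Submodule.coe_sub, Submodule.coe_smul, Submodule.coe_smul]
  exact (R.dir f.1.1).sub_mem
    ((R.dir f.1.1).smul_mem _ (R.dir_mono (S.tail_lt f).le (S.pos_mem _)))
    ((R.dir f.1.1).smul_mem _ (S.dir_mem f))

theorem LocalFramework.headDir_perp (f : {f : Face C d // v.1 < f.1}) :
    ⟪S.pos (S.head f), S.headDir f⟫ = 0 := by
  rw [S.pos_head, SphericalFramework.headDir]
  simp only [inner_add_left, inner_sub_right, inner_smul_left, inner_smul_right,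
    real_inner_self_eq_norm_sq, S.norm_pos, S.norm_dir, S.dir_perp, real_inner_comm,
    RCLike.conj_to_real]
  ring

/-- A vector of the plane of `f` that is orthogonal to the plane of `v` and to the position of `e`
is a multiple of the normal of `e` in `f`. -/
theorem LocalFramework.exists_smul_n (N : Normals R) (e : {e : Edge C d // v.1 < e.1})
    {f : Face C d} (hef : e.1.1 < f.1) {x : (R.dir v.1)ᗮ}
    (hx : (x : EuclideanSpace ℝ (Fin (d + 1))) ∈ R.dir f.1) (hperp : ⟪S.pos e, x⟫ = 0) :
    ∃ ε : ℝ, (x : EuclideanSpace ℝ (Fin (d + 1))) = ε • N.n e.1 f := by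
  refine exists_smul_eq_of_mem_orthogonal (R.dir_mono hef.le) (R.finrank_dir_face e.1 f)
    (N.mem _ _ hef) (N.perp _ _ hef) (N.n_ne_zero hef) hx ?_
  have hle : R.dir e.1.1 ≤ (ℝ ∙ (x : EuclideanSpace ℝ (Fin (d + 1))))ᗮ := by
    refine le_of_mem_of_mem_orthogonal (K := R.dir v.1) (R.dir_mono e.2.le) ?_ (S.pos_mem e)
      (S.pos e).2 ?_ ?_ ?_
    · have h1 := v.2
      have h2 := e.1.2
      rw [R.finrank_dir, R.finrank_dir]
      omega
    · intro h
      have := S.norm_pos e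
      rw [Submodule.coe_eq_zero.1 h, norm_zero] at this
      exact zero_ne_one this
    · intro y hy
      rw [Submodule.mem_orthogonal_singleton_iff_inner_left]
      exact x.2 y hy
    · rw [Submodule.mem_orthogonal_singleton_iff_inner_left]
      exact hperp
  intro y hy
  exact Submodule.mem_orthogonal_singleton_iff_inner_left.1 (hle hy)

/-- The two edges of a face at `v` are the only cells between `v` and this face, so the incidence
numbers along the two sides of the diamond cancel. -/
theorem LocalFramework.inc_add_inc (N : Normals R) (f : {f : Face C d // v.1 < f.1}) :
    N.orientation.inc f.1.1 (S.tail f).1.1 * N.orientation.inc (S.tail f).1.1 v.1 +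
      N.orientation.inc f.1.1 (S.head f).1.1 * N.orientation.inc (S.head f).1.1 v.1 = 0 := by
  classical
  have hv := v.2
  have hf := f.1.2
  have hdimE : ∀ e : {e : Edge C d // v.1 < e.1}, e.1.1.dim = v.1.dim + 1 := fun e => by
    have := e.1.2
    omega
  -- The terms of the square relation are indexed by exactly the two edges of `f` at `v`.
  have hsq := N.orientation.square f.1.1 v.1 f.2 (by omega)
  let a : {y : Cell C // y.dim = v.1.dim + 1 ∧ v.1 < y ∧ y < f.1.1} :=
    ⟨(S.tail f).1.1, hdimE _, (S.tail f).2, S.tail_lt f⟩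
  let b : {y : Cell C // y.dim = v.1.dim + 1 ∧ v.1 < y ∧ y < f.1.1} :=
    ⟨(S.head f).1.1, hdimE _, (S.head f).2, S.head_lt f⟩
  have hab : a ≠ b := fun h => by
    have h' := Subtype.ext_iff.1 h
    exact S.tail_ne_head f (Subtype.ext (Subtype.ext h'))
  have hall : ∀ y : {y : Cell C // y.dim = v.1.dim + 1 ∧ v.1 < y ∧ y < f.1.1},
      y ∈ ({a, b} : Finset _) := by
    rintro ⟨y, hy1, hy2, hy3⟩
    have := (S.ends f ⟨⟨y, by omega⟩, hy2⟩).1 hy3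
    rw [Finset.mem_insert, Finset.mem_singleton]
    rcases this with h | h
    · exact Or.inl (Subtype.ext (congrArg (fun e => e.1.1) h))
    · exact Or.inr (Subtype.ext (congrArg (fun e => e.1.1) h))
  rw [finsum_eq_sum_of_support_subset (s := {a, b}) _ (fun y _ => hall y),
    Finset.sum_pair hab] at hsq
  exact hsq

/-- The unit tangents of the arcs of the spherical framework of `v` and the normals `n(e, f)` are
proportional, with factors that split into a factor for the edge and a factor for the face. -/
theorem LocalFramework.exists_factors (N : Normals R) :
    ∃ (μ : {e : Edge C d // v.1 < e.1} → ℝ) (η : {f : Face C d // v.1 < f.1} → ℝ),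
      (∀ e, μ e ≠ 0) ∧ (∀ f, η f ≠ 0) ∧ ∀ f,
        μ (S.tail f) • (S.dir f : EuclideanSpace ℝ (Fin (d + 1))) = η f • N.n (S.tail f).1 f.1 ∧
        μ (S.head f) • (S.headDir f : EuclideanSpace ℝ (Fin (d + 1))) =
          η f • N.n (S.head f).1 f.1 := by
  have hv := v.2
  have hdimE : ∀ e : {e : Edge C d // v.1 < e.1}, e.1.1.dim = v.1.dim + 1 := fun e => by
    have := e.1.2
    omega
  have hdimF : ∀ f : {f : Face C d // v.1 < f.1}, f.1.1.dim = v.1.dim + 2 := fun f => by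
    have := f.1.2
    omega
  let bv : Fin v.1.dim → EuclideanSpace ℝ (Fin (d + 1)) := fun i => (N.basis v.1 i : _)
  let w : {e : Edge C d // v.1 < e.1} → Fin (v.1.dim + 1) → EuclideanSpace ℝ (Fin (d + 1)) :=
    fun e => Fin.cons (S.pos e : _) bv
  have hwmem : ∀ e i, w e i ∈ R.dir e.1.1 := by
    intro e i
    refine Fin.cases (S.pos_mem e) (fun k => ?_) i
    exact R.dir_mono e.2.le (N.basis v.1 k).2
  have hwon : ∀ e, Orthonormal ℝ (w e) := by
    intro e
    have hbv : Orthonormal ℝ bv :=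
      (N.basis v.1).orthonormal.comp_linearIsometry (R.dir v.1).subtypeₗᵢ
    refine ⟨fun i => Fin.cases (S.norm_pos e) (fun k => hbv.1 k) i, fun i j => ?_⟩
    refine Fin.cases ?_ (fun k => ?_) i <;> refine Fin.cases ?_ (fun l => ?_) j
    · exact fun h => absurd rfl h
    · exact fun _ => Submodule.inner_left_of_mem_orthogonal (N.basis v.1 l).2 (S.pos e).2
    · exact fun _ => Submodule.inner_right_of_mem_orthogonal (N.basis v.1 k).2 (S.pos e).2
    · exact fun h => hbv.2 fun h' => h (congrArg Fin.succ h')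
  let ν : {e : Edge C d // v.1 < e.1} → ℝ := fun e =>
    frameDet (fun i => (N.basisCast e.1.1 (hdimE e) i : EuclideanSpace ℝ (Fin (d + 1)))) (w e)
  have hν : ∀ e, ν e ≠ 0 := fun e => frameDet_ne_zero _ (hwon e) (hwmem e)
  have hinc : ∀ e : {e : Edge C d // v.1 < e.1}, N.orientation.inc e.1.1 v.1 = 1 ∨
      N.orientation.inc e.1.1 v.1 = -1 := fun e =>
    N.orientation.unit e.1.1 v.1 e.2 (hdimE e).symm
  have hincF : ∀ (e : {e : Edge C d // v.1 < e.1}) (f : {f : Face C d // v.1 < f.1}),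
      e.1.1 < f.1.1 → N.orientation.inc f.1.1 e.1.1 = 1 ∨ N.orientation.inc f.1.1 e.1.1 = -1 :=
    fun e f h => N.orientation.unit f.1.1 e.1.1 h (by rw [hdimE, hdimF])
  -- The frame of a multiple of the normal of `e`, the position of `e`, and the basis at `v`.
  have hdet : ∀ (e : {e : Edge C d // v.1 < e.1}) (f : {f : Face C d // v.1 < f.1}),
      e.1.1 < f.1.1 → ∀ ε : ℝ,
      frameDet (fun i => (N.basisCast f.1.1 (hdimF f) i : EuclideanSpace ℝ (Fin (d + 1))))
        (Fin.cons (ε • N.n e.1 f.1) (w e)) = ν e * (ε * N.orientation.inc f.1.1 e.1.1) := by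
    intro e f hef ε
    rw [frameDet_cons _ _ (N.basisCast e.1.1 (hdimE e)) (hwmem e)]
    congr 1
    rw [← N.frameDet_normal hef (hdimE e) (hdimF f)]
    exact congrArg (fun F => F fun i =>
        (N.basisCast e.1.1 (hdimE e) i : EuclideanSpace ℝ (Fin (d + 1))))
      ((frameDet (fun i => (N.basisCast f.1.1 (hdimF f) i :
        EuclideanSpace ℝ (Fin (d + 1))))).curryLeft.map_smul ε (N.n e.1 f.1))
  have hε : ∀ f, ∃ ε : ℝ, (S.dir f : EuclideanSpace ℝ (Fin (d + 1))) =
      ε • N.n (S.tail f).1 f.1 := fun f =>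
    S.exists_smul_n N (S.tail f) (S.tail_lt f) (S.dir_mem f) (S.dir_perp f)
  have hε' : ∀ f, ∃ ε : ℝ, (S.headDir f : EuclideanSpace ℝ (Fin (d + 1))) =
      ε • N.n (S.head f).1 f.1 := fun f =>
    S.exists_smul_n N (S.head f) (S.head_lt f) (S.headDir_mem f) (S.headDir_perp f)
  choose ε hε using hε
  choose ε' hε' using hε'
  have hε0 : ∀ f, ε f ≠ 0 := by
    intro f h
    have h1 := hε f
    rw [h, zero_smul, Submodule.coe_eq_zero] at h1
    have := S.norm_dir f
    rw [h1, norm_zero] at this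
    exact zero_ne_one this
  let μ : {e : Edge C d // v.1 < e.1} → ℝ := fun e => ν e * N.orientation.inc e.1.1 v.1
  have hμ : ∀ e, μ e ≠ 0 := by
    intro e
    refine mul_ne_zero (hν e) ?_
    rcases hinc e with h | h <;> rw [h] <;> norm_num
  -- Both ends of the arc give the same factor: passing from one end to the other changes the sign
  -- of the frame (`alternating_rotate`) and the sign of the product of incidence numbers.
  have hfactor : ∀ f, μ (S.head f) * ε' f = μ (S.tail f) * ε f := by
    intro f
    have h1 := hdet (S.tail f) f (S.tail_lt f) (ε f)
    have h2 := hdet (S.head f) f (S.head_lt f) (ε' f)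
    rw [← hε f] at h1
    rw [← hε' f] at h2
    have h3 : (S.headDir f : EuclideanSpace ℝ (Fin (d + 1))) =
        Real.sin (S.angle f) • (S.pos (S.tail f) : EuclideanSpace ℝ (Fin (d + 1))) -
          Real.cos (S.angle f) • (S.dir f : EuclideanSpace ℝ (Fin (d + 1))) := rfl
    have h4 : (S.pos (S.head f) : EuclideanSpace ℝ (Fin (d + 1))) =
        Real.cos (S.angle f) • (S.pos (S.tail f) : EuclideanSpace ℝ (Fin (d + 1))) +
          Real.sin (S.angle f) • (S.dir f : EuclideanSpace ℝ (Fin (d + 1))) :=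
      congrArg Subtype.val (S.pos_head f)
    have h5 : w (S.head f) = Fin.cons
        (Real.cos (S.angle f) • (S.pos (S.tail f) : EuclideanSpace ℝ (Fin (d + 1))) +
          Real.sin (S.angle f) • (S.dir f : EuclideanSpace ℝ (Fin (d + 1)))) bv := by
      rw [← h4]
    rw [h5, h3, alternating_rotate] at h2
    change frameDet _ (Fin.cons _ (Fin.cons _ bv)) = _ at h1
    rw [h1] at h2
    have h6 : ((N.orientation.inc f.1.1 (S.tail f).1.1 : ℝ) *
        N.orientation.inc (S.tail f).1.1 v.1 + N.orientation.inc f.1.1 (S.head f).1.1 *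
          N.orientation.inc (S.head f).1.1 v.1) = 0 := by
      exact_mod_cast S.inc_add_inc N f
    have sq : ∀ z : ℤ, z = 1 ∨ z = -1 → (z : ℝ) * z = 1 := by
      rintro z (h | h) <;> rw [h] <;> norm_num
    have h7 := sq _ (hincF (S.tail f) f (S.tail_lt f))
    have h8 := sq _ (hincF (S.head f) f (S.head_lt f))
    change ν (S.head f) * N.orientation.inc (S.head f).1.1 v.1 * ε' f =
      ν (S.tail f) * N.orientation.inc (S.tail f).1.1 v.1 * ε f
    generalize (N.orientation.inc f.1.1 (S.tail f).1.1 : ℝ) = x at *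
    generalize (N.orientation.inc f.1.1 (S.head f).1.1 : ℝ) = x' at *
    generalize (N.orientation.inc (S.tail f).1.1 v.1 : ℝ) = y at *
    generalize (N.orientation.inc (S.head f).1.1 v.1 : ℝ) = y' at *
    linear_combination (-(x' * y')) * h2 - ν (S.tail f) * ε f * x * h6 +
      ν (S.tail f) * ε f * y * h7 - ν (S.head f) * ε' f * y' * h8
  refine ⟨μ, fun f => μ (S.tail f) * ε f, hμ, fun f => mul_ne_zero (hμ _) (hε0 f), fun f =>
    ⟨?_, ?_⟩⟩
  · rw [hε f, smul_smul]
  · rw [hε' f, smul_smul, hfactor]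

theorem finsum_subtype_eq_sum_ite {ι M : Type*} [Fintype ι] [AddCommMonoid M] (P : ι → Prop)
    [DecidablePred P] (g : ι → M) : ∑ᶠ a : {a // P a}, g a.1 = ∑ a, if P a then g a else 0 := by
  rw [finsum_subtype_eq_finsum_cond (f := g) P, finsum_eq_sum_of_fintype]
  exact Finset.sum_congr rfl fun a _ => finsum_eq_if

/-- Equilibrium of the spherical framework of `v` at an edge is equilibrium of the framework, for
stresses that differ by the factors of the faces. -/
theorem LocalFramework.equilibrium_iff [Finite (Cell C)] (N : Normals R)
    {μ : {e : Edge C d // v.1 < e.1} → ℝ} {η : {f : Face C d // v.1 < f.1} → ℝ}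
    (hμ : ∀ e, μ e ≠ 0)
    (hfac : ∀ f, μ (S.tail f) • (S.dir f : EuclideanSpace ℝ (Fin (d + 1))) =
        η f • N.n (S.tail f).1 f.1 ∧
      μ (S.head f) • (S.headDir f : EuclideanSpace ℝ (Fin (d + 1))) = η f • N.n (S.head f).1 f.1)
    {w : {f : Face C d // v.1 < f.1} → ℝ} {s : Face C d → ℝ} (hs : ∀ f, s f.1 = w f * η f)
    (e : {e : Edge C d // v.1 < e.1}) :
    (∑ᶠ a : {a // S.tail a = e}, w a.1 • S.dir a.1) +
      (∑ᶠ a : {a // S.head a = e}, w a.1 • S.headDir a.1) = 0 ↔ N.EquilibriumAt s e.1 := by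
  classical
  let _ := Fintype.ofFinite {f : Face C d // v.1 < f.1}
  have h1 : ∑ᶠ f : {f : Face C d // e.1.1 < f.1}, s f.1 • N.n e.1 f.1 =
      ∑ᶠ a : {a : {f : Face C d // v.1 < f.1} // e.1.1 < a.1.1}, s a.1.1 • N.n e.1 a.1.1 :=
    finsum_eq_of_bijective (fun f => ⟨⟨f.1, e.2.trans f.2⟩, f.2⟩)
      ⟨fun f g h => Subtype.ext (congrArg (fun a => a.1.1) h),
        fun a => ⟨⟨a.1.1, a.2⟩, rfl⟩⟩ fun f => rfl
  rw [Normals.EquilibriumAt, h1,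
    finsum_subtype_eq_sum_ite (fun a : {f : Face C d // v.1 < f.1} => e.1.1 < a.1.1)
      (fun a => s a.1 • N.n e.1 a.1),
    finsum_subtype_eq_sum_ite (fun a => S.tail a = e) (fun a => w a • S.dir a),
    finsum_subtype_eq_sum_ite (fun a => S.head a = e) (fun a => w a • S.headDir a),
    ← Finset.sum_add_distrib, ← Submodule.coe_eq_zero, AddSubmonoidClass.coe_finsetSum]
  have h2 : ∑ a : {f : Face C d // v.1 < f.1}, (if e.1.1 < a.1.1 then s a.1 • N.n e.1 a.1 else 0) =
      μ e • ∑ a : {f : Face C d // v.1 < f.1},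
        ((((if S.tail a = e then w a • S.dir a else 0) +
          (if S.head a = e then w a • S.headDir a else 0) : (R.dir v.1)ᗮ)) :
            EuclideanSpace ℝ (Fin (d + 1))) := by
    rw [Finset.smul_sum]
    refine Finset.sum_congr rfl fun a _ => ?_
    by_cases ht : S.tail a = e
    · have hh : ¬ S.head a = e := fun h => S.tail_ne_head a (ht.trans h.symm)
      rw [if_pos ((S.ends a e).2 (Or.inl ht.symm)), if_pos ht, if_neg hh, add_zero, hs]
      subst ht
      rw [Submodule.coe_smul, smul_comm, (hfac a).1, smul_smul]
    · by_cases hh : S.head a = e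
      · rw [if_pos ((S.ends a e).2 (Or.inr hh.symm)), if_neg ht, if_pos hh, zero_add, hs]
        subst hh
        rw [Submodule.coe_smul, smul_comm, (hfac a).2, smul_smul]
      · rw [if_neg (fun h => ((S.ends a e).1 h).elim (fun h => ht h.symm) fun h => hh h.symm),
          if_neg ht, if_neg hh, add_zero, Submodule.coe_zero, smul_zero]
  rw [h2, smul_eq_zero, or_iff_right (hμ e)]

theorem LocalFramework.selfStressable_of_nonvanishing [Finite (Cell C)] (N : Normals R)
    (hne : Nonempty {f : Face C d // v.1 < f.1}) {s : Face C d → ℝ} (hs0 : ∀ f, s f ≠ 0)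
    (hs : ∀ e, N.EquilibriumAt s e) : S.SelfStressable := by
  obtain ⟨μ, η, hμ, hη, hfac⟩ := S.exists_factors N
  obtain ⟨f⟩ := hne
  refine ⟨fun f => s f.1 / η f, fun h => ?_, fun e => ?_⟩
  · exact div_ne_zero (hs0 f.1) (hη f) (congrFun h f)
  · exact (S.equilibrium_iff N hμ hfac (fun f => (div_mul_cancel₀ _ (hη f)).symm) e).2 (hs e.1)

theorem LocalFramework.exists_stress_of_selfStressable [Finite (Cell C)] (N : Normals R)
    (h : S.SelfStressable) : ∃ s : Face C d → ℝ, (∃ f : Face C d, v.1 < f.1 ∧ s f ≠ 0) ∧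
      ∀ e : Edge C d, v.1 < e.1 → N.EquilibriumAt s e := by
  classical
  obtain ⟨μ, η, hμ, hη, hfac⟩ := S.exists_factors N
  obtain ⟨w, hw0, hw⟩ := h
  obtain ⟨f, hf⟩ := Function.ne_iff.1 hw0
  refine ⟨fun f => if h : v.1 < f.1 then w ⟨f, h⟩ * η ⟨f, h⟩ else 0, ⟨f.1, f.2, ?_⟩,
    fun e he => ?_⟩
  · simp only [dif_pos f.2]
    exact mul_ne_zero hf (hη f)
  · exact (S.equilibrium_iff N hμ hfac (fun f => dif_pos f.2) ⟨e, he⟩).1 (hw ⟨e, he⟩)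

/-- If the spherical framework of `v` is self-stressable and the link of `v` is connected, the
coefficients of equilibrium are a coboundary around `v`. -/
theorem LocalFramework.exists_potential [Finite (Cell C)] {N : Normals R}
    {c : Edge C d → Face C d → Additive ℝˣ} (hc : N.IsCoefficients c)
    (hconn : ∀ y z : Set.Ioi v.1, Relation.EqvGen (fun a b => a ≤ b) y z)
    (h : S.SelfStressable) : ∃ φ : Face C d ⊕ Edge C d → Additive ℝˣ,
      ∀ e f, v.1 < e.1 → e.1 < f.1 → c e f = φ (Sum.inl f) - φ (Sum.inr e) := by
  obtain ⟨s, ⟨f₀, hf₀, hs₀⟩, hs⟩ := S.exists_stress_of_selfStressable N h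
  have hv := v.2
  have hface : ∀ f g : Face C d, f.1 ≤ g.1 → f = g := by
    intro f g hfg
    rcases Cell.eq_or_dim_lt_of_le hfg with h | h
    · exact Subtype.ext h
    · rw [f.2, g.2] at h
      exact absurd h (lt_irrefl _)
  -- Non-vanishing on all faces above a cell spreads along the link of `v`.
  have key : ∀ a b : Set.Ioi v.1, Relation.EqvGen (fun a b => a ≤ b) a b →
      ((∀ f : Face C d, a.1 ≤ f.1 → s f ≠ 0) ↔ ∀ f : Face C d, b.1 ≤ f.1 → s f ≠ 0) := by
    intro a b hab
    induction hab with
    | rel a b hab =>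
      refine ⟨fun ha f hf => ha f (le_trans hab hf), fun hb f hf => ?_⟩
      rcases Cell.eq_or_lt_of_le (x := a.1) (y := b.1) hab with h | h
      · exact hb f (h ▸ hf)
      · have h1 := Cell.dim_lt_dim a.2
        have h2 := Cell.dim_lt_dim h
        have h3 := R.dim_le b.1
        have ha : a.1.dim + 1 = d := by omega
        have hb' : b.1.dim = d := by omega
        have hf' : a.1 < f.1 := by
          rcases Cell.eq_or_lt_of_le hf with h4 | h4
          · have := f.2
            rw [← h4] at this
            omega
          · exact h4
        exact hc.ne_zero_of_ne_zero (hs ⟨a.1, ha⟩ a.2) (f := ⟨b.1, hb'⟩) h hf'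
          (hb ⟨b.1, hb'⟩ le_rfl)
    | refl a => exact Iff.rfl
    | symm a b _ ih => exact ih.symm
    | trans a b c _ _ ih1 ih2 => exact ih1.trans ih2
  obtain ⟨φ, hφ⟩ := hc.exists_potential (S := {e | v.1 < e.1}) hs (fun e he f hf => by
    refine (key ⟨f₀.1, hf₀⟩ ⟨f.1, lt_trans he hf⟩ (hconn _ _)).1 ?_ f le_rfl
    intro g hg
    rw [← hface f₀ g hg]
    exact hs₀)
  exact ⟨φ, fun e f he hf => hφ e he f hf⟩

end Local

/-! ### The criterion by generators of the first homology -/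

section Global

variable {X : Type u} [TopologicalSpace X] {C : Set X} [Topology.CWComplex C] {d : ℕ}
  {R : RFramework C d} {N : Normals R} {c : Edge C d → Face C d → Additive ℝˣ}

/-- Face-cycles with trivial stress monodromy that generate the first homology force a
self-stress, once the coefficients of equilibrium extend to a cocycle. -/
theorem Normals.IsCoefficients.selfStressable_of_generateH1 [Finite (Cell C)]
    (hc : N.IsCoefficients c) (hne : Nonempty (Face C d)) {w : Cell C → Cell C → Additive ℝˣ}
    (hw : ∀ a b c, a < b → b < c → w a c = w a b + w b c)
    (hwc : ∀ (e : Edge C d) (f : Face C d), e.1 < f.1 → w e.1 f.1 = c e f) {k : ℕ}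
    {γ : Fin k → FaceCycle C d} (hγ : GenerateH1 γ) (hmon : ∀ i, N.TrivialMonodromy (γ i)) :
    N.SelfStressable := by
  have hgain : ∀ γ : FaceCycle C d, evalChain w γ.chain = γ.gain c := by
    intro γ
    rw [FacePath.evalChain_chain]
    refine Finset.sum_congr rfl fun i _ => ?_
    exact congrArg₂ (· - ·) (hwc _ _ (γ.right i)) (hwc _ _ (γ.left i))
  have hcycle : ∀ γ : FaceCycle C d, bd1 (Cell C) γ.chain = 0 := fun γ => by
    rw [FacePath.bd1_chain, γ.closed, sub_self]
  refine hc.selfStressable_of_loops hne fun δ _ => ?_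
  rw [← hgain]
  refine evalChain_eq_zero_of_span hw (fun i => ⟨(γ i).chain, hcycle (γ i)⟩) hγ (fun i => ?_) _
    (hcycle δ)
  exact (hgain (γ i)).trans (hc.gain_eq_zero (hmon i))

/-- Above every `(d-2)`-cell with non-empty link there is a face. -/
theorem nonempty_face_above (htri : Trivalent C d) (hdim : ∀ x : Cell C, x.dim ≤ d)
    (v : DVertex C d) (h : Nonempty (Set.Ioi v.1)) : Nonempty {f : Face C d // v.1 < f.1} := by
  obtain ⟨⟨y, hy⟩⟩ := h
  have h1 := Cell.dim_lt_dim hy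
  have h2 := hdim y
  have h3 := v.2
  by_cases hyd : y.dim = d
  · exact ⟨⟨⟨y, hyd⟩, hy⟩⟩
  · have hye : y.dim + 1 = d := by omega
    have hcard := htri ⟨y, hye⟩
    have : Nonempty {f : Face C d // y < f.1} := by
      by_contra hempty
      rw [not_nonempty_iff] at hempty
      rw [Nat.card_of_isEmpty] at hcard
      exact absurd hcard (by decide)
    obtain ⟨f, hf⟩ := this
    exact ⟨⟨f, lt_trans hy hf⟩⟩

end Global

end RFw

end

theorem mainTheorem7 {X : Type*} [TopologicalSpace X] [T2Space X] (C : Set X)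
    [Topology.CWComplex C] [Topology.RelCWComplex.Finite C] (hreg : RFw.IsRegular C)
    (d : ℕ) (hd : 1 ≤ d) (R : RFw.RFramework C d)
    (hgen : R.Generic) (htri : RFw.Trivalent C d) (hconn : RFw.FaceConnected C d)
    (N : RFw.Normals R) :
    (N.SelfStressable ↔ ∀ γ : RFw.FaceCycle C d, γ.IsLoop → N.TrivialMonodromy γ) ∧
    (RFw.LinkCondition C d →
      (∃ (k : ℕ) (γ : Fin k → RFw.FaceCycle C d), RFw.GenerateH1 γ) ∧
      ∀ S : (v : RFw.DVertex C d) → RFw.LocalFramework R v,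
        (N.SelfStressable ↔
          (∀ v, (S v).SelfStressable) ∧
          ∃ (k : ℕ) (γ : Fin k → RFw.FaceCycle C d),
            RFw.GenerateH1 γ ∧ ∀ i, N.TrivialMonodromy (γ i)) ∧
        (∀ (k : ℕ) (γ : Fin k → RFw.FaceCycle C d), RFw.GenerateH1 γ →
          (N.SelfStressable ↔
            (∀ v, (S v).SelfStressable) ∧ ∀ i, N.TrivialMonodromy (γ i))) ∧
        (SimplyConnectedSpace C →
          (N.SelfStressable ↔ ∀ v, (S v).SelfStressable))) := by
  have hfin : Finite (RFw.Cell C) := RFw.finite_cell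
  obtain ⟨c, hc⟩ := N.exists_isCoefficients hgen htri
  have hmon : N.SelfStressable → ∀ γ : RFw.FaceCycle C d, N.TrivialMonodromy γ := by
    intro h
    obtain ⟨s, hs0, hs⟩ := hc.exists_nonvanishing hconn h
    exact RFw.Normals.trivialMonodromy_of_nonvanishing hs0 hs
  refine ⟨⟨fun h γ _ => hmon h γ, fun h => ?_⟩, fun hlink => ?_⟩
  · exact hc.selfStressable_of_loops hconn.1 fun γ hγ => hc.gain_eq_zero (h γ hγ)
  have hgenerate := RFw.exists_generateH1 R.dim_le hlink
  refine ⟨hgenerate, fun S => ?_⟩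
  have hlocal : N.SelfStressable → ∀ v, (S v).SelfStressable := by
    intro h v
    obtain ⟨s, hs0, hs⟩ := hc.exists_nonvanishing hconn h
    exact (S v).selfStressable_of_nonvanishing N (RFw.nonempty_face_above htri R.dim_le v
      (hlink.1 v.1 v.2.le).1) hs0 hs
  have hcocycle : (∀ v, (S v).SelfStressable) → ∃ w : RFw.Cell C → RFw.Cell C → Additive ℝˣ,
      (∀ a b c, a < b → b < c → w a c = w a b + w b c) ∧
        ∀ (e : RFw.Edge C d) (f : RFw.Face C d), e.1 < f.1 → w e.1 f.1 = c e f := fun h =>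
    RFw.exists_cocycle_of_local R.dim_le hlink fun v =>
      (S v).exists_potential hc (hlink.1 v.1 v.2.le).2 (h v)
  have hback : (∀ v, (S v).SelfStressable) → ∀ (k : ℕ) (γ : Fin k → RFw.FaceCycle C d),
      RFw.GenerateH1 γ → (∀ i, N.TrivialMonodromy (γ i)) → N.SelfStressable := by
    intro h k γ hγ htriv
    obtain ⟨w, hw, hwc⟩ := hcocycle h
    exact hc.selfStressable_of_generateH1 hconn.1 hw hwc hγ htriv
  refine ⟨⟨fun h => ⟨hlocal h, ?_⟩, ?_⟩, fun k γ hγ => ⟨fun h => ⟨hlocal h, fun i => hmon h _⟩,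
    fun h => hback h.1 k γ hγ h.2⟩, fun hsc => ⟨hlocal, fun h => ?_⟩⟩
  · obtain ⟨k, γ, hγ⟩ := hgenerate
    exact ⟨k, γ, hγ, fun i => hmon h _⟩
  · rintro ⟨h, k, γ, hγ, htriv⟩
    exact hback h k γ hγ htriv
  · obtain ⟨w, hw, hwc⟩ := hcocycle h
    obtain ⟨g, hg⟩ := hreg.exists_potential_of_simplyConnected hw
    refine hc.selfStressable_of_potential hconn.1
      (φ := Sum.elim (fun f => g f.1) fun e => g e.1) fun e f hef => ?_
    rw [← hwc e f hef]
    exact hg _ _ hef
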